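/- Let $N\ge 1$ and $0\le p\le N$ be integers, and let $g,d>0$. For $v\in\mathbb C^N$ write $[v]=(|v_1|^2,\dots,|v_p|^2)$. There is a $\delta_0>0$, depending only on $N,p,g,d$, such that the following holds. Let $\mathcal T,\mathcal X\subset\mathbb R$ be open neighbourhoods of $[0,1]$ and let $(t,x)\mapsto H(t,x)$ be a $C^\infty$ map from $\mathcal T\times\mathcal X^p$ to the self-adjoint operators on $\mathbb C^N$ such that: - $\|\partial_{x_j}H(t,x)\|\le\delta$ for all $(t,x)\in\mathcal T\times\mathcal X^p$ and $1\le j\le p$, for some $0<\delta<\delta_0$; - for all $(t,x)\in\mathcal T\times\mathcal X^p$, $H(t,x)$ has $N$ distinct (hence simple) eigenvalues $\lambda_1(t,x)<\dots<\lambda_N(t,x)$, and any two of them are at distance at least $g$; - $H(t,x)$ is real (its matrix in the standard basis has real entries); - for one fixed index $j_0$ and $\lambda=\lambda_{j_0}$, $\ \sigma(H(t,x)-\lambda(t,x))\cap\sigma(-H(t,x)+\lambda(t,x))=\{0\}$ for all $(t,x)\in\mathcal T\times\mathcal X^p$; and at $t=0$, for all $x\in[0,1]^p$, the nonzero elements of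 the first set are at distance at least $d$ from the nonzero elements of the second. (Given the first condition, the second one always holds for some $d>0$, by compactness; it only records what the smallness of $\delta$ depends on.) Let $\omega$ be an instantaneous nonlinear eigenvector on an open neighbourhood $\mathcal T_1\subset\mathcal T$ of $0$, that is, a $C^\infty$ map $\omega:\mathcal T_1\to\mathbb C^N$ with $\|\omega(t)\|=1$, $\langle\omega(t)|\partial_t\omega(t)\rangle=0$ and $H(t,[\omega(t)])\,\omega(t)=\lambda(t,[\omega(t)])\,\omega(t)$ for all $t\in\mathcal T_1$. Then there is an open interval $\mathcal T_0\subset\mathcal T_1$ containing $0$, independent of $\varepsilon$, such that for every $t\in\mathcal T_0$ there is a constant $C_t$ with the following property: for every $\varepsilon>0$, the solution $v^\varepsilon$ on $\mathcal T_0$ of $$i\varepsilon\,\partial_t v^\varepsilon(t)=H(t,[v^\varepsilon(t)])\,v^\varepsilon(t),\qquad v^\varepsilon(0)=\omega(0),$$ satisfies $$\Big\|v^\varepsilon(t)-e^{-\frac i\varepsilon\int_0^t\lambda(s,[\omega(s)])\,ds}\,\omega(t)\Big\|\le C_t\,\varepsilon .$$ -/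

import Mathlib

open Set
open scoped ContDiff

namespace NonlinearAdiabatic

/-- Bounded operators on `ℂ^N`, with the Euclidean norm on `ℂ^N` and the operator norm. -/
abbrev Op (N : ℕ) : Type :=
  EuclideanSpace ℂ (Fin N) →L[ℂ] EuclideanSpace ℂ (Fin N)

/-- `[v] = (|v_1|^2, …, |v_p|^2)`: squared moduli of the first `p` coordinates of `v`. -/
noncomputable def occ {N p : ℕ} (hp : p ≤ N) (v : EuclideanSpace ℂ (Fin N)) : Fin p → ℝ :=
  fun k => ‖v (Fin.castLE hp k)‖ ^ 2

/-- The parameter domain `T × X^p`. -/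
def paramDomain (p : ℕ) (T X : Set ℝ) : Set (ℝ × (Fin p → ℝ)) :=
  T ×ˢ Set.univ.pi (fun _ => X)

/-- Coordinatewise complex conjugation on `ℂ^N`. -/
def conjVec {N : ℕ} (v : EuclideanSpace ℂ (Fin N)) : EuclideanSpace ℂ (Fin N) :=
  WithLp.toLp 2 (fun i => star (v i))

/-- An operator `A` is real if `C A C = A`, with `C` the complex conjugation. -/
def IsRealOp {N : ℕ} (A : Op N) : Prop :=
  ∀ v : EuclideanSpace ℂ (Fin N), conjVec (A (conjVec v)) = A v

/-- `(t, x) ↦ H (t, x)` is a smooth map into the self-adjoint operators on `T × X^p`, where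
`T` and `X` are open neighbourhoods of `[0, 1]`. -/
structure SmoothSelfAdjoint {N p : ℕ} (T X : Set ℝ) (H : ℝ × (Fin p → ℝ) → Op N) : Prop where
  isOpen_T : IsOpen T
  isOpen_X : IsOpen X
  subset_T : Icc (0 : ℝ) 1 ⊆ T
  subset_X : Icc (0 : ℝ) 1 ⊆ X
  smooth : ContDiffOn ℝ ∞ H (paramDomain p T X)
  selfAdjoint : ∀ q ∈ paramDomain p T X, IsSelfAdjoint (H q)

/-- `‖∂_{x_j} H(t, x)‖ ≤ δ` on `T × X^p`, for all `j`. -/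
def PartialsBounded {N p : ℕ} (T X : Set ℝ) (H : ℝ × (Fin p → ℝ) → Op N) (δ : ℝ) : Prop :=
  ∀ t x, (t, x) ∈ paramDomain p T X → ∀ j : Fin p,
    ‖fderiv ℝ (fun y : Fin p → ℝ => H (t, y)) x (Pi.single j 1)‖ ≤ δ

/-- On `T × X^p` the spectrum of `H (t, x)` consists of the `N` eigenvalues
`lam 0 < lam 1 < ⋯` (numbered increasingly), which are at distance at least `g` from one
another. On `ℂ^N`, having `N` distinct eigenvalues means that all of them are simple. -/
structure SimpleGappedSpectrum {N p : ℕ} (T X : Set ℝ) (H : ℝ × (Fin p → ℝ) → Op N)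
    (lam : Fin N → ℝ × (Fin p → ℝ) → ℝ) (g : ℝ) : Prop where
  spectrum_eq : ∀ q ∈ paramDomain p T X,
    spectrum ℂ (H q) = Set.range (fun j : Fin N => ((lam j q : ℝ) : ℂ))
  gap : ∀ q ∈ paramDomain p T X, ∀ i j : Fin N, i < j → lam i q + g ≤ lam j q

/-- Genericity: `σ(H - λ) ∩ σ(-H + λ) = {0}` on `T × X^p`. -/
def Generic {N p : ℕ} (T X : Set ℝ) (H : ℝ × (Fin p → ℝ) → Op N)
    (lam₀ : ℝ × (Fin p → ℝ) → ℝ) : Prop :=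
  ∀ q ∈ paramDomain p T X,
    spectrum ℂ (H q - ((lam₀ q : ℝ) : ℂ) • (1 : Op N)) ∩
      spectrum ℂ (-H q + ((lam₀ q : ℝ) : ℂ) • (1 : Op N)) = {0}

/-- `d` bounds from below the distance between the nonzero points of `σ(H - λ)` and those of
`σ(-H + λ)` at time `0`, for `x ∈ [0, 1]^p`; here `λ = lam j₀`. -/
def GenericMargin {N p : ℕ} (lam : Fin N → ℝ × (Fin p → ℝ) → ℝ) (j₀ : Fin N) (d : ℝ) : Prop :=
  ∀ x : Fin p → ℝ, (∀ k, x k ∈ Icc (0 : ℝ) 1) → ∀ i j : Fin N, i ≠ j₀ → j ≠ j₀ →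
    d ≤ |(lam i (0, x) - lam j₀ (0, x)) - (-lam j (0, x) + lam j₀ (0, x))|

/-- `w` is an instantaneous nonlinear eigenvector on the set `S` of times, for the eigenvalue
branch `lam₀`: it is smooth, normalised, satisfies `H(t,[w(t)]) w(t) = λ(t,[w(t)]) w(t)` and
`⟨w(t), ∂_t w(t)⟩ = 0`. -/
structure IsNonlinearEigenvector {N p : ℕ} (hp : p ≤ N) (H : ℝ × (Fin p → ℝ) → Op N)
    (lam₀ : ℝ × (Fin p → ℝ) → ℝ) (S : Set ℝ) (w : ℝ → EuclideanSpace ℂ (Fin N)) : Prop where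
  smooth : ContDiffOn ℝ ∞ w S
  norm_eq : ∀ t ∈ S, ‖w t‖ = 1
  eigen : ∀ t ∈ S, H (t, occ hp (w t)) (w t) = ((lam₀ (t, occ hp (w t)) : ℝ) : ℂ) • w t
  parallel : ∀ t ∈ S, inner ℂ (w t) (deriv w t) = 0

/-- `v` solves `i ε ∂_t v = H(t, [v]) v` at all times of the open set `S`. -/
def IsSolution {N p : ℕ} (hp : p ≤ N) (H : ℝ × (Fin p → ℝ) → Op N) (ε : ℝ) (S : Set ℝ)
    (v : ℝ → EuclideanSpace ℂ (Fin N)) : Prop :=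
  ∀ t ∈ S, DifferentiableAt ℝ v t ∧
    (Complex.I * (ε : ℂ)) • deriv v t = H (t, occ hp (v t)) (v t)

end NonlinearAdiabatic

/-! The equation sees phases only through `v` itself, since `occ` ignores them. Removing the
dynamical phase, together with one constant phase, turns the instantaneous eigenvector into a real
unit vector `r t` (`exists_phase_of_parallel`) and the solution into `u = r + a + i b` with `a`, `b`
real and zero at time 0. As `H` is real, linearisation gives `ε a' = K b - ε r'`, `ε b' = -M a` up
to errors quadratic in `(a, b)`. Here `K = H - λ` is symmetric with kernel spanned by `r`, and `M =
K + B`, where `B` comes from differentiating `H` in the occupation numbers. `B` is not symmetric, so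
stability on times of order 1, that is over `1/ε` oscillations, is not automatic.

The squared generator is governed by `K M`. For `B = 0` it is `K ^ 2`, with eigenvalues `κ j ^ 2`.
The gap and the margin `d` at time 0 keep the numbers `|κ j|` apart, so for `δ` small against `g`
and `d` the spectrum of `K M` stays real, simple and nonnegative, with 0 in place `j₀`
(`exists_charpoly_comp_eq_nodal`). Simple eigenvalues and their spectral projections are `C¹` in
time, and out of them one builds an energy `⟨P a, a⟩ + ⟨Q b, b⟩` conserved by the frozen linear flow
(`exists_symmetrizer`).

This energy degenerates in one direction of `a` and one of `b`. For `a`, conservation of `‖u‖ = 1`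
makes `⟨r, a⟩` quadratic. For `b`, there is a vector `y` with `⟨y, r⟩ = 1` for which `⟨y, M a⟩` is a
multiple of `⟨r, a⟩`, so that `⟨y, b⟩` moves slowly.

The forcing `ε r'` is orthogonal to `r`, hence equals `ε K s`, and is absorbed by `z = b - ε s`. As
long as `a`, `b` are of size `ε`, the energy starts at order `ε ^ 2` and has a derivative of order
`ε ^ 2`. On a short interval independent of `ε` a continuity argument closes the estimate
(`exists_uniform_bound`). For `ε` bounded below the claim is trivial, both vectors being normalised.
-/

namespace NonlinearAdiabatic

/-! ### Real simple spectrum of `K (K + B)` for small non-symmetric `B` -/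

section Roots

variable {ι V : Type*} [Fintype ι] [NormedAddCommGroup V] [InnerProductSpace ℝ V]

/-- Parseval for a diagonal operator: a lower bound for the eigenvalues is a lower bound for the
operator. -/
theorem le_norm_apply_of_eigenbasis (e : OrthonormalBasis ι ℝ V) {κ : ι → ℝ} {K : V →L[ℝ] V}
    (hK : ∀ j, K (e j) = κ j • e j) {c : ℝ} (hc : 0 ≤ c) {x : V}
    (h : ∀ j, inner ℝ (e j) x ≠ 0 → c ≤ |κ j|) : c * ‖x‖ ≤ ‖K x‖ := by
  have hKx : K x = ∑ j, (inner ℝ (e j) x * κ j) • e j := by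
    conv_lhs => rw [← e.sum_repr' x]
    simp [map_sum, hK, smul_smul]
  have hco : ∀ j, inner ℝ (e j) (K x) = inner ℝ (e j) x * κ j := by
    intro j
    rw [hKx, e.orthonormal.inner_right_fintype]
  have h1 := e.sum_sq_norm_inner_right (𝕜 := ℝ) x
  have h2 := e.sum_sq_norm_inner_right (𝕜 := ℝ) (K x)
  refine le_of_sq_le_sq ?_ (norm_nonneg _)
  rw [mul_pow, ← h1, ← h2, Finset.mul_sum]
  refine Finset.sum_le_sum fun j _ => ?_
  rw [hco, norm_mul, mul_pow, mul_comm]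
  by_cases h0 : inner ℝ (e j) x = 0
  · simp [h0]
  · gcongr
    exact h j h0

/-- Distinct roots give coprime linear factors, and there are as many of them as the degree. -/
theorem charpoly_eq_nodal [DecidableEq ι] [FiniteDimensional ℝ V] (A : V →ₗ[ℝ] V) {μ : ι → ℝ}
    (hcard : Module.finrank ℝ V = Fintype.card ι) (hμ : Function.Injective μ)
    (h : ∀ i, A.charpoly.IsRoot (μ i)) : A.charpoly = Lagrange.nodal Finset.univ μ := by
  refine Polynomial.eq_of_monic_of_dvd_of_natDegree_le (Lagrange.nodal_monic) A.charpoly_monic ?_ ?_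
  · rw [Lagrange.nodal]
    refine Finset.prod_dvd_of_coprime ?_ fun i _ => Polynomial.dvd_iff_isRoot.2 (h i)
    exact fun i _ j _ hij => Polynomial.pairwise_coprime_X_sub_C hμ hij
  · rw [A.charpoly_natDegree, Lagrange.natDegree_nodal, hcard]; rfl

variable [FiniteDimensional ℝ V]

theorem eval_charpoly_diagonal [DecidableEq ι] (e : OrthonormalBasis ι ℝ V) {κ : ι → ℝ}
    {K : V →L[ℝ] V} (hK : ∀ j, K (e j) = κ j • e j) (y : ℝ) :
    (LinearMap.charpoly (K : V →ₗ[ℝ] V)).eval y = ∏ j, (y - κ j) := by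
  rw [LinearMap.eval_charpoly, ← LinearMap.det_toMatrix e.toBasis]
  have : LinearMap.toMatrix e.toBasis e.toBasis (algebraMap ℝ (V →ₗ[ℝ] V) y - (K : V →ₗ[ℝ] V))
      = Matrix.diagonal (fun j => y - κ j) := by
    ext i j
    rw [LinearMap.toMatrix_apply]
    simp only [OrthonormalBasis.coe_toBasis, LinearMap.sub_apply, Module.algebraMap_end_apply,
      ContinuousLinearMap.coe_coe, hK, ← sub_smul, map_smul]
    simp only [Finsupp.smul_apply, smul_eq_mul, Matrix.diagonal_apply]
    have h1 : e.toBasis.repr (e j) = Finsupp.single j 1 := by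
      rw [← e.coe_toBasis, Module.Basis.repr_self]
    rw [h1, Finsupp.single_apply]
    by_cases hij : i = j
    · simp [hij]
    · simp [hij, Ne.symm hij]
  rw [this, Matrix.det_diagonal]

/-- If `±x` keeps distance `m / 2` from the spectrum of the symmetric operator `K`, then `x ^ 2`
is not an eigenvalue of `K (K + s B)`. -/
theorem eval_charpoly_ne_zero_of_dist (e : OrthonormalBasis ι ℝ V) {κ : ι → ℝ} {K B : V →L[ℝ] V}
    (hK : ∀ j, K (e j) = κ j • e j) {m η x : ℝ} (hm : 0 < m) (hη : η < m / 2) (hx : 0 < x)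
    (hB : ∀ v, ‖B v‖ ≤ η * ‖v‖) (hd : ∀ j, m / 2 ≤ |x - (|κ j|)|) :
    (LinearMap.charpoly (K ∘L (K + B) : V →L[ℝ] V).toLinearMap).eval (x ^ 2) ≠ 0 := by
  rw [LinearMap.eval_charpoly]
  intro h0
  obtain ⟨a, ha, ha0⟩ := (Submodule.ne_bot_iff _).1 (LinearMap.bot_lt_ker_of_det_eq_zero h0).ne'
  have hKa : K (K a + B a) = x ^ 2 • a := by
    have := LinearMap.mem_ker.1 ha
    simp only [LinearMap.sub_apply, Module.algebraMap_end_apply, ContinuousLinearMap.coe_coe,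
      ContinuousLinearMap.comp_apply, add_apply, sub_eq_zero] at this
    exact this.symm
  -- An eigenvector `a` for `x ^ 2` is doubled to a solution of `K b = x a`, `K a + B a = x b`. Then
  -- `a + b` and `a - b` are approximate eigenvectors of `K` for `x` and `-x`, both with defect `-B
  -- a`. The distance of `±x` from the spectrum yields `m / 2 * ‖a‖ ≤ η * ‖a‖`, a contradiction.
  obtain ⟨b, hb⟩ : ∃ b, K a + B a = x • b := ⟨x⁻¹ • (K a + B a), by rw [smul_inv_smul₀ hx.ne']⟩
  have hKb : K b = x • a := by
    rw [hb, map_smul, sq, mul_smul] at hKa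
    exact smul_right_injective V hx.ne' hKa
  have hKa' : K a = x • b - B a := by rw [← hb]; abel
  have hp : ∀ σ : ℝ, (σ = 1 ∨ σ = -1) → ∀ v, m / 2 * ‖v‖ ≤ ‖K v - (σ * x) • v‖ := by
    intro σ hσ v
    have := le_norm_apply_of_eigenbasis e (K := K - (σ * x) • ContinuousLinearMap.id ℝ V)
      (κ := fun j => κ j - σ * x) (c := m / 2) (x := v)
      (fun j => by simp [hK, sub_smul]) (by positivity) (fun j _ => by
        refine (hd j).trans ?_
        have h1 := abs_abs_sub_abs_le_abs_sub (κ j) (σ * x)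
        have h2 : |σ * x| = x := by
          rcases hσ with rfl | rfl <;> simp [abs_of_pos hx]
        rw [h2] at h1
        rwa [abs_sub_comm])
    simpa using this
  have h1 := hp 1 (Or.inl rfl) (a + b)
  have h2 := hp (-1) (Or.inr rfl) (a - b)
  have e1 : K (a + b) - (1 * x) • (a + b) = -B a := by
    rw [map_add, hKa', hKb]; module
  have e2 : K (a - b) - (-1 * x) • (a - b) = -B a := by
    rw [map_sub, hKa', hKb]; module
  rw [e1, norm_neg] at h1
  rw [e2, norm_neg] at h2
  have h3 := hB a
  have h4 : ‖a‖ ≤ (‖a + b‖ + ‖a - b‖) / 2 := by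
    have : a = (2⁻¹ : ℝ) • ((a + b) + (a - b)) := by module
    calc ‖a‖ = ‖(2⁻¹ : ℝ) • ((a + b) + (a - b))‖ := by rw [← this]
      _ ≤ 2⁻¹ * (‖a + b‖ + ‖a - b‖) := by
        rw [norm_smul, Real.norm_of_nonneg (by norm_num)]; gcongr; exact norm_add_le _ _
      _ = _ := by ring
  have h5 : 0 < ‖a‖ := norm_pos_iff.2 ha0
  nlinarith

/-- If the eigenvalues of a symmetric operator `K` are nondegenerate also up to sign, then a small
(not necessarily symmetric) perturbation `M` of `K` is such that `K M` has real simple spectrum,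
nonnegative and with the eigenvalue `0` in the place of the one of `K`. -/
theorem exists_charpoly_comp_eq_nodal [DecidableEq ι] (e : OrthonormalBasis ι ℝ V) {κ : ι → ℝ}
    {K B : V →L[ℝ] V} (hK : ∀ j, K (e j) = κ j • e j) {j₀ : ι} (hj₀ : κ j₀ = 0)
    {m η : ℝ} (hm : 0 < m) (hη : η < m / 2) (hB : ∀ v, ‖B v‖ ≤ η * ‖v‖)
    (hsub : ∀ i j, i ≠ j → m ≤ |κ i - κ j|) (hadd : ∀ i j, i ≠ j → m ≤ |κ i + κ j|) :
    ∃ μ : ι → ℝ, Function.Injective μ ∧ μ j₀ = 0 ∧ (∀ i, i ≠ j₀ → 0 < μ i) ∧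
      LinearMap.charpoly (K ∘L (K + B) : V →L[ℝ] V).toLinearMap
        = Lagrange.nodal Finset.univ μ := by
  have habs : ∀ i j, i ≠ j → m ≤ |(|κ i| - |κ j|)| := by
    intro i j hij
    rcases abs_cases (κ i) with ⟨h1, _⟩ | ⟨h1, _⟩ <;> rcases abs_cases (κ j) with ⟨h2, _⟩ | ⟨h2, _⟩
    · rw [h1, h2]; exact hsub i j hij
    · rw [h1, h2, sub_neg_eq_add]; exact hadd i j hij
    · rw [h1, h2, ← abs_neg]; convert! hadd i j hij using 2; ring
    · rw [h1, h2, ← abs_neg]; convert! hsub i j hij using 2; ring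
  have hpos : ∀ i, i ≠ j₀ → m ≤ |κ i| := by
    intro i hi
    simpa [hj₀] using habs i j₀ hi
  -- Homotopy from `K ^ 2` at `s = 0` to `K (K + B)` at `s = 1`, read in the variable `x` whose
  -- square is the eigenvalue.
  let F : ℝ → ℝ → ℝ := fun s x =>
    (LinearMap.charpoly (K ∘L (K + s • B) : V →L[ℝ] V).toLinearMap).eval (x ^ 2)
  have hF : ∀ s x, F s x = ((x ^ 2) • ContinuousLinearMap.id ℝ V - K ∘L (K + s • B)).det := by
    intro s x
    simp only [F, LinearMap.eval_charpoly]
    rfl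
  have hFs : ∀ x, Continuous fun s => F s x := by
    intro x
    simp only [hF]
    exact ContinuousLinearMap.continuous_det.comp (by fun_prop)
  have hFx : ∀ s, Continuous fun x => F s x := by
    intro s
    simp only [hF]
    exact ContinuousLinearMap.continuous_det.comp (by fun_prop)
  have hne : ∀ s ∈ Icc (0 : ℝ) 1, ∀ x, 0 < x → (∀ j, m / 2 ≤ |x - (|κ j|)|) → F s x ≠ 0 := by
    intro s hs x hx hd
    refine eval_charpoly_ne_zero_of_dist e hK hm hη hx (fun v => ?_) hd
    rw [smul_apply, norm_smul, Real.norm_of_nonneg hs.1]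
    calc s * ‖B v‖ ≤ 1 * ‖B v‖ := by gcongr; exact hs.2
      _ ≤ _ := by rw [one_mul]; exact hB v
  -- No zero crosses such an `x` during the homotopy, so the sign of the explicit product `F 0 x` is
  -- inherited by `F 1 x`.
  have hsign : ∀ x, 0 < x → (∀ j, m / 2 ≤ |x - (|κ j|)|) → 0 < F 0 x * F 1 x := by
    intro x hx hd
    by_contra hcon
    have h1 : (0 : ℝ) ∈ (fun s => F s x) '' Icc 0 1 := by
      have hc : ContinuousOn (fun s => F s x) (Icc 0 1) := (hFs x).continuousOn
      rcases mul_nonpos_iff.1 (not_lt.1 hcon) with h | h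
      · exact intermediate_value_Icc' zero_le_one hc ⟨h.2, h.1⟩
      · exact intermediate_value_Icc zero_le_one hc ⟨h.1, h.2⟩
    obtain ⟨s, hs, h0⟩ := h1
    exact hne s hs x hx hd h0
  have hF0 : ∀ x, F 0 x = ∏ j, (x ^ 2 - κ j ^ 2) := by
    intro x
    refine eval_charpoly_diagonal e (κ := fun j => κ j ^ 2) (fun j => ?_) _
    simp [hK, sq, smul_smul]
  have hroot : ∀ i, i ≠ j₀ → ∃ x, 0 < x ∧ |x - (|κ i|)| < m / 2 ∧ F 1 x = 0 := by
    intro i hi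
    have hi' := hpos i hi
    set c := |κ i| with hc
    have hdm : ∀ σ : ℝ, |σ| = 1 → ∀ j, m / 2 ≤ |c + σ * (m / 2) - (|κ j|)| := by
      intro σ hσ j
      by_cases hij : i = j
      · subst hij
        rw [← hc, add_sub_cancel_left, abs_mul, hσ, one_mul]
        exact le_abs_self _
      · have h1 := habs i j hij
        have h2 : |c - (|κ j|)| ≤ |c + σ * (m / 2) - (|κ j|)| + |σ * (m / 2)| := by
          have := abs_sub (c + σ * (m / 2) - |κ j|) (σ * (m / 2))
          convert! this using 2; ring
        rw [abs_mul σ, hσ, abs_of_pos (half_pos hm)] at h2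
        linarith
    have hm1 : ∀ j, m / 2 ≤ |c - m / 2 - (|κ j|)| := by
      intro j; convert! hdm (-1) (by simp) j using 2; ring
    have hp1 : ∀ j, m / 2 ≤ |c + m / 2 - (|κ j|)| := by
      intro j; convert! hdm 1 (by simp) j using 2; ring
    have s1 := hsign (c - m / 2) (by linarith) hm1
    have s2 := hsign (c + m / 2) (by linarith) hp1
    -- Between the ends of the window around `|κ i|` only the factor of index `i` changes sign. The
    -- resulting sign change of `F 1` produces a real root.
    have s3 : F 0 (c - m / 2) * F 0 (c + m / 2) < 0 := by
      rw [hF0, hF0, ← Finset.prod_mul_distrib, ← Finset.mul_prod_erase _ _ (Finset.mem_univ i)]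
      refine mul_neg_of_neg_of_pos ?_ (Finset.prod_pos fun j hj => ?_)
      · rw [← sq_abs (κ i), ← hc]
        exact mul_neg_of_neg_of_pos (by nlinarith) (by nlinarith)
      · have hij := habs i j (Finset.ne_of_mem_erase hj).symm
        rw [← hc] at hij
        rw [← sq_abs (κ j)]
        have := abs_nonneg (κ j)
        rcases le_abs.1 hij with h | h
        · exact mul_pos (by nlinarith) (by nlinarith)
        · exact mul_pos_of_neg_of_neg (by nlinarith) (by nlinarith)
    have s4 : F 1 (c - m / 2) * F 1 (c + m / 2) < 0 := by
      by_contra hcon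
      have := mul_pos s1 s2
      nlinarith [mul_nonneg (neg_nonneg.2 s3.le) (not_lt.1 hcon)]
    have h1 : (0 : ℝ) ∈ F 1 '' Icc (c - m / 2) (c + m / 2) := by
      rcases mul_neg_iff.1 s4 with h | h
      · exact intermediate_value_Icc' (by linarith) (hFx 1).continuousOn ⟨h.2.le, h.1.le⟩
      · exact intermediate_value_Icc (by linarith) (hFx 1).continuousOn ⟨h.1.le, h.2.le⟩
    obtain ⟨x, hx, h0⟩ := h1
    have hxl : x ≠ c - m / 2 := by rintro rfl; simp [h0] at s4
    have hxr : x ≠ c + m / 2 := by rintro rfl; simp [h0] at s4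
    have hx1 := lt_of_le_of_ne hx.1 hxl.symm
    have hx2 := lt_of_le_of_ne hx.2 hxr
    exact ⟨x, by linarith, abs_lt.2 ⟨by linarith, by linarith⟩, h0⟩
  choose! ξ hξ0 hξ1 hξ2 using hroot
  -- Zero fills the remaining place: it is a root because `det K = 0`. The windows of radius `m / 2`
  -- around the `|κ i|` are disjoint, so all these roots are distinct.
  let ν : ι → ℝ := fun i => if i = j₀ then 0 else ξ i
  have hν0 : ν j₀ = 0 := by simp [ν]
  have hν : ∀ i, i ≠ j₀ → ν i = ξ i := fun i hi => by simp [ν, hi]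
  have hνn : ∀ i, 0 ≤ ν i := fun i => by
    by_cases hi : i = j₀
    · rw [hi, hν0]
    · rw [hν i hi]; exact (hξ0 i hi).le
  have hνd : ∀ i, |ν i - (|κ i|)| < m / 2 := fun i => by
    by_cases hi : i = j₀
    · rw [hi, hν0, hj₀]; simpa using hm
    · rw [hν i hi]; exact hξ1 i hi
  have hinj : Function.Injective fun i => ν i ^ 2 := by
    intro i j hij
    have h1 : ν i = ν j := (pow_left_inj₀ (hνn i) (hνn j) two_ne_zero).1 hij
    by_contra hne'
    have h2 := habs i j hne'
    have h3 := abs_lt.1 (hνd i)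
    have h4 := abs_lt.1 (hνd j)
    have h5 : |(|κ i| - |κ j|)| < m := abs_lt.2 ⟨by linarith, by linarith⟩
    linarith
  have hF1 : ∀ i, F 1 (ν i) = 0 := by
    intro i
    by_cases hi : i = j₀
    · have hdet : (K : V →ₗ[ℝ] V).det = 0 := by
        have := eval_charpoly_diagonal e hK 0
        rw [Finset.prod_eq_zero (Finset.mem_univ j₀) (by simp [hj₀]), LinearMap.eval_charpoly,
          map_zero, zero_sub, ← neg_one_smul ℝ, LinearMap.det_smul] at this
        exact (mul_eq_zero.1 this).resolve_left (pow_ne_zero _ (by norm_num))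
      rw [hi, hν0, hF]
      have : (0 : ℝ) ^ 2 • ContinuousLinearMap.id ℝ V - K ∘L (K + (1 : ℝ) • B)
          = (-K) ∘L (K + (1 : ℝ) • B) := by ext; simp [add_comm]
      rw [this]
      change LinearMap.det ((-(K : V →ₗ[ℝ] V)) ∘ₗ (K + (1 : ℝ) • B : V →L[ℝ] V).toLinearMap) = 0
      rw [LinearMap.det_comp, ← neg_one_smul ℝ, LinearMap.det_smul, hdet]
      simp
    · rw [hν i hi]; exact hξ2 i hi
  refine ⟨fun i => ν i ^ 2, hinj, by simp [hν0], fun i hi => ?_, ?_⟩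
  · simp only [hν i hi]; exact pow_pos (hξ0 i hi) 2
  · refine charpoly_eq_nodal _ (Module.finrank_eq_card_basis e.toBasis) hinj fun i => ?_
    have := hF1 i
    simpa [F] using this

end Roots

end NonlinearAdiabatic

namespace NonlinearAdiabatic

open Filter Topology

/-! ### Differentiable branches of simple eigenvalues -/

section SmoothSpectrum

variable {ι V : Type*} [Fintype ι] [NormedAddCommGroup V] [InnerProductSpace ℝ V]
  [FiniteDimensional ℝ V]

theorem contDiff_continuousLinearMap_det {n : ℕ∞ω} :
    ContDiff ℝ n fun A : V →L[ℝ] V => A.det := by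
  let b := Module.finBasis ℝ V
  have h : (fun A : V →L[ℝ] V => A.det)
      = fun A : V →L[ℝ] V => ∑ σ : Equiv.Perm (Fin (Module.finrank ℝ V)),
        Equiv.Perm.sign σ • ∏ i, b.repr (A (b i)) (σ i) := by
    ext A
    change LinearMap.det (A : V →ₗ[ℝ] V) = _
    rw [← LinearMap.det_toMatrix b, Matrix.det_apply]
    simp [LinearMap.toMatrix_apply]
  rw [h]
  refine ContDiff.sum fun σ _ => ContDiff.const_smul _ (contDiff_prod fun i _ => ?_)
  let L : (V →L[ℝ] V) →ₗ[ℝ] ℝ :=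
    { toFun := fun A => b.repr (A (b i)) (σ i)
      map_add' := by simp
      map_smul' := by simp }
  exact (LinearMap.toContinuousLinearMap L).contDiff

theorem contDiff_adjoint {n : ℕ∞ω} :
    ContDiff ℝ n fun A : V →L[ℝ] V => ContinuousLinearMap.adjoint A := by
  let L : (V →L[ℝ] V) →ₗ[ℝ] (V →L[ℝ] V) :=
    { toFun := fun A => ContinuousLinearMap.adjoint A
      map_add' := by simp
      map_smul' := by simp }
  exact (LinearMap.toContinuousLinearMap L).contDiff

/-- A simple real eigenvalue of a `C¹` family of operators extends to a `C¹` branch. -/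
theorem exists_contDiffAt_isRoot_charpoly {A : ℝ → V →L[ℝ] V} {t₀ x₀ : ℝ}
    (hA : ContDiffAt ℝ 1 A t₀) (h0 : (LinearMap.charpoly (A t₀ : V →ₗ[ℝ] V)).IsRoot x₀)
    (h1 : (LinearMap.charpoly (A t₀ : V →ₗ[ℝ] V)).derivative.eval x₀ ≠ 0) :
    ∃ x : ℝ → ℝ, ContDiffAt ℝ 1 x t₀ ∧ x t₀ = x₀ ∧
      ∀ᶠ t in 𝓝 t₀, (LinearMap.charpoly (A t : V →ₗ[ℝ] V)).IsRoot (x t) := by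
  let f : ℝ × ℝ → ℝ := fun q => (LinearMap.charpoly (A q.1 : V →ₗ[ℝ] V)).eval q.2
  have hf : ContDiffAt ℝ 1 f (t₀, x₀) := by
    have : f = fun q => (q.2 • ContinuousLinearMap.id ℝ V - A q.1).det := by
      ext q
      simp only [f, LinearMap.eval_charpoly]
      rfl
    rw [this]
    refine contDiff_continuousLinearMap_det.contDiffAt.comp (t₀, x₀) ?_
    refine ContDiffAt.sub (contDiffAt_snd.smul contDiffAt_const) ?_
    exact ContDiffAt.comp (t₀, x₀) hA contDiffAt_fst
  -- The partial derivative in the spectral variable is the derivative of the characteristic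
  -- polynomial, nonzero at a simple root: the implicit function theorem applies.
  have hd : (fderiv ℝ f (t₀, x₀) ∘L .inr ℝ ℝ ℝ) 1
      = (LinearMap.charpoly (A t₀ : V →ₗ[ℝ] V)).derivative.eval x₀ := by
    have e1 : HasFDerivAt (fun x : ℝ => (t₀, x)) (ContinuousLinearMap.inr ℝ ℝ ℝ) x₀ :=
      hasFDerivAt_prodMk_right t₀ x₀
    have e2 := ((hf.differentiableAt one_ne_zero).hasFDerivAt.comp x₀ e1).hasDerivAt
    exact e2.unique ((LinearMap.charpoly (A t₀ : V →ₗ[ℝ] V)).hasDerivAt x₀)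
  have hinv : (fderiv ℝ f (t₀, x₀) ∘L .inr ℝ ℝ ℝ).IsInvertible := by
    refine ⟨ContinuousLinearEquiv.unitsEquivAut ℝ (Units.mk0 _ h1), ?_⟩
    ext
    simp [← hd]
  refine ⟨hf.implicitFunction one_ne_zero hinv, hf.contDiffAt_implicitFunction one_ne_zero hinv,
    hf.implicitFunction_apply_self one_ne_zero hinv, ?_⟩
  filter_upwards [hf.eventually_apply_implicitFunction one_ne_zero hinv] with t ht
  exact ht.trans h0

/-- Each simple root is continued separately. By continuity the branches stay distinct for nearby
times, and by degree they then exhaust the spectrum. -/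
theorem exists_contDiffAt_charpoly_eq_nodal [DecidableEq ι] {A : ℝ → V →L[ℝ] V} {t₀ : ℝ}
    (hA : ContDiffAt ℝ 1 A t₀) {μ₀ : ι → ℝ} (hμ₀ : Function.Injective μ₀)
    (hchar : LinearMap.charpoly (A t₀ : V →ₗ[ℝ] V) = Lagrange.nodal Finset.univ μ₀) :
    ∃ μ : ι → ℝ → ℝ, (∀ i, ContDiffAt ℝ 1 (μ i) t₀) ∧ (∀ i, μ i t₀ = μ₀ i) ∧
      ∀ᶠ t in 𝓝 t₀, Function.Injective (fun i => μ i t) ∧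
        LinearMap.charpoly (A t : V →ₗ[ℝ] V) = Lagrange.nodal Finset.univ fun i => μ i t := by
  have hcard : Module.finrank ℝ V = Fintype.card ι := by
    rw [← LinearMap.charpoly_natDegree (A t₀ : V →ₗ[ℝ] V), hchar, Lagrange.natDegree_nodal]; rfl
  have hex : ∀ i, ∃ x : ℝ → ℝ, ContDiffAt ℝ 1 x t₀ ∧ x t₀ = μ₀ i ∧
      ∀ᶠ t in 𝓝 t₀, (LinearMap.charpoly (A t : V →ₗ[ℝ] V)).IsRoot (x t) := by
    intro i
    refine exists_contDiffAt_isRoot_charpoly hA ?_ ?_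
    · rw [hchar]; exact Lagrange.eval_nodal_at_node (Finset.mem_univ i)
    · rw [hchar, Lagrange.eval_nodal_derivative_eval_node_eq (Finset.mem_univ i)]
      refine Lagrange.eval_nodal_not_at_node fun j hj h => ?_
      exact Finset.ne_of_mem_erase hj (hμ₀ h).symm
  choose μ h1 h2 h3 using hex
  refine ⟨μ, h1, h2, ?_⟩
  have hinj : ∀ᶠ t in 𝓝 t₀, ∀ i j, i ≠ j → μ i t ≠ μ j t := by
    refine eventually_all.2 fun i => eventually_all.2 fun j => ?_
    by_cases hij : i = j
    · simp [hij]
    · have hne : μ i t₀ - μ j t₀ ≠ 0 := by rw [h2, h2]; exact sub_ne_zero.2 (hμ₀.ne hij)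
      filter_upwards [((h1 i).sub (h1 j)).continuousAt.eventually_ne hne] with t ht _
      exact sub_ne_zero.1 ht
  filter_upwards [hinj, eventually_all.2 h3] with t ht ht'
  have hi : Function.Injective (fun i => μ i t) := fun i j hij => by
    by_contra hne
    exact ht i j hne hij
  exact ⟨hi, charpoly_eq_nodal _ hcard hi ht'⟩

theorem aeval_continuousLinearMap_charpoly (A : V →L[ℝ] V) :
    Polynomial.aeval A (LinearMap.charpoly (A : V →ₗ[ℝ] V)) = 0 := by
  let φ : (V →L[ℝ] V) →ₐ[ℝ] (V →ₗ[ℝ] V) :=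
    { ContinuousLinearMap.toLinearMapRingHom with commutes' := fun _ => rfl }
  have h := Polynomial.aeval_algHom_apply φ A (LinearMap.charpoly (A : V →ₗ[ℝ] V))
  rw [show φ A = (A : V →ₗ[ℝ] V) from rfl, LinearMap.aeval_self_charpoly] at h
  ext x
  exact (congrArg (fun B : V →ₗ[ℝ] V => B x) h).symm

end SmoothSpectrum

/-! ### Spectral projections as Lagrange interpolation polynomials -/

section SpectralProjection

variable {ι V : Type*} [Fintype ι] [DecidableEq ι] [NormedAddCommGroup V] [InnerProductSpace ℝ V]

/-- The spectral projections of an operator with simple spectrum `μ`, by Lagrange interpolation. -/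
noncomputable def spectralProj (A : V →L[ℝ] V) (μ : ι → ℝ) (i : ι) : V →L[ℝ] V :=
  Polynomial.aeval A (Lagrange.basis Finset.univ μ i)

theorem sum_spectralProj [Nonempty ι] (A : V →L[ℝ] V) {μ : ι → ℝ} (hμ : Function.Injective μ) :
    ∑ i, spectralProj A μ i = 1 := by
  simp only [spectralProj]
  rw [← map_sum, Lagrange.sum_basis hμ.injOn Finset.univ_nonempty, map_one]

theorem spectralProj_mul_comm (A : V →L[ℝ] V) (μ : ι → ℝ) (i : ι) :
    A * spectralProj A μ i = spectralProj A μ i * A := by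
  have h : Polynomial.aeval A (Polynomial.X * Lagrange.basis Finset.univ μ i)
      = Polynomial.aeval A (Lagrange.basis Finset.univ μ i * Polynomial.X) := by rw [mul_comm]
  rwa [map_mul, map_mul, Polynomial.aeval_X] at h

/-- `X - μ i` times the Lagrange basis polynomial is a multiple of the nodal polynomial, which is
the characteristic polynomial; Cayley–Hamilton kills it. -/
theorem mul_spectralProj [FiniteDimensional ℝ V] {A : V →L[ℝ] V} {μ : ι → ℝ}
    (hchar : LinearMap.charpoly (A : V →ₗ[ℝ] V) = Lagrange.nodal Finset.univ μ) (i : ι) :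
    A * spectralProj A μ i = μ i • spectralProj A μ i := by
  have h : (Polynomial.X - Polynomial.C (μ i)) * Lagrange.basis Finset.univ μ i
      = Polynomial.C (Lagrange.nodalWeight Finset.univ μ i) * Lagrange.nodal Finset.univ μ := by
    rw [Lagrange.basis_eq_prod_sub_inv_mul_nodal_div (Finset.mem_univ i),
      ← Lagrange.nodal_erase_eq_nodal_div (Finset.mem_univ i),
      Lagrange.nodal_eq_mul_nodal_erase (Finset.mem_univ i)]
    ring
  have h2 := congrArg (Polynomial.aeval A) h
  rw [map_mul, map_mul, ← hchar, aeval_continuousLinearMap_charpoly, mul_zero, map_sub,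
    Polynomial.aeval_X, Polynomial.aeval_C, sub_mul, sub_eq_zero, ← Algebra.smul_def] at h2
  exact h2

/-- Tested against a left null vector, a polynomial in `A` acts through its constant term, and the
Lagrange basis polynomial takes the value 1 at the node 0. This lets `⟨r, a⟩` control the neutral
component of `a`. -/
theorem inner_spectralProj_of_left_kernel {A : V →L[ℝ] V} {μ : ι → ℝ} (hμ : Function.Injective μ)
    {i : ι} (hi : μ i = 0) {r : V} (hr : ∀ x, inner ℝ r (A x) = 0) (x : V) :
    inner ℝ r (spectralProj A μ i x) = inner ℝ r x := by
  have h1 : (Lagrange.basis Finset.univ μ i).coeff 0 = 1 := by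
    rw [Polynomial.coeff_zero_eq_eval_zero, ← hi]
    exact Lagrange.eval_basis_self hμ.injOn (Finset.mem_univ i)
  rw [spectralProj, ← Polynomial.X_mul_divX_add (Lagrange.basis Finset.univ μ i), map_add, h1,
    map_mul, Polynomial.aeval_X]
  simp [inner_add_right, hr]

theorem contDiffAt_spectralProj {A : ℝ → V →L[ℝ] V} {μ : ι → ℝ → ℝ} {t₀ : ℝ}
    (hA : ContDiffAt ℝ 1 A t₀) (hμ : ∀ i, ContDiffAt ℝ 1 (μ i) t₀)
    (hinj : Function.Injective fun i => μ i t₀) (i : ι) :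
    ContDiffAt ℝ 1 (fun t => spectralProj (A t) (fun j => μ j t) i) t₀ := by
  simp only [spectralProj, Lagrange.basis]
  have h : ∀ s : Finset ι, i ∉ s → ContDiffAt ℝ 1 (fun t => Polynomial.aeval (A t)
      (∏ j ∈ s, Lagrange.basisDivisor (μ i t) (μ j t))) t₀ := by
    intro s
    induction s using Finset.induction_on with
    | empty => intro _; simpa using contDiffAt_const
    | insert j s hj ih =>
      intro hi
      rw [Finset.mem_insert, not_or] at hi
      simp only [Finset.prod_insert hj, map_mul]
      refine ContDiffAt.mul ?_ (ih hi.2)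
      simp only [Lagrange.basisDivisor, map_mul, map_sub, Polynomial.aeval_X, Polynomial.aeval_C,
        Algebra.algebraMap_eq_smul_one, smul_mul_assoc, one_mul]
      have := ((hμ i).sub (hμ j)).inv (sub_ne_zero.2 (hinj.ne hi.1))
      exact this.smul (hA.sub ((hμ j).smul contDiffAt_const))
  exact h _ (Finset.notMem_erase i _)

end SpectralProjection

end NonlinearAdiabatic

namespace NonlinearAdiabatic

open Filter Topology

/-! ### Conserved quadratic energy of the frozen linear flow -/

section Symmetrizer

variable {V : Type*} [NormedAddCommGroup V] [InnerProductSpace ℝ V]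

/-- `K` is symmetric with kernel spanned by the unit vector `r`, and is bounded below by `g` on the
orthogonal complement of `r`. -/
structure GappedAt (K : V →L[ℝ] V) (r : V) (g : ℝ) : Prop where
  symm : ∀ x y, inner ℝ (K x) y = inner ℝ x (K y)
  apply_eq : K r = 0
  norm_eq : ‖r‖ = 1
  bound : ∀ x, inner ℝ r x = 0 → g * ‖x‖ ≤ ‖K x‖

namespace GappedAt

variable {K M : V →L[ℝ] V} {r : V} {g : ℝ}

theorem inner_apply (h : GappedAt K r g) (x : V) : inner ℝ r (K x) = 0 := by
  rw [← h.symm, h.apply_eq, inner_zero_left]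

theorem inner_self (h : GappedAt K r g) : inner ℝ r r = (1 : ℝ) := by
  rw [real_inner_self_eq_norm_sq, h.norm_eq, one_pow]

theorem inner_sub (h : GappedAt K r g) (x : V) : inner ℝ r (x - (inner ℝ r x : ℝ) • r) = 0 := by
  rw [inner_sub_right, inner_smul_right, h.inner_self, mul_one, sub_self]

theorem bound_sub (h : GappedAt K r g) (x : V) :
    g * ‖x - (inner ℝ r x : ℝ) • r‖ ≤ ‖K x‖ := by
  have := h.bound _ (h.inner_sub x)
  rwa [map_sub, map_smul, h.apply_eq, smul_zero, sub_zero] at this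

theorem eq_smul_of_apply_eq_zero (h : GappedAt K r g) (hg : 0 < g) {x : V} (hx : K x = 0) :
    x = (inner ℝ r x : ℝ) • r := by
  have := h.bound_sub x
  rw [hx, norm_zero] at this
  have h0 : ‖x - (inner ℝ r x : ℝ) • r‖ ≤ 0 := by
    by_contra hcon
    nlinarith [mul_pos hg (not_le.1 hcon)]
  exact sub_eq_zero.1 (norm_le_zero_iff.1 h0)

/-- The kernel of `K M` is close to the line spanned by `r`. -/
theorem norm_le_of_apply_apply_eq_zero (h : GappedAt K r g) (hg : 0 < g)
    (hM : ∀ x, ‖M x - K x‖ ≤ g / 4 * ‖x‖) {x : V} (hx : K (M x) = 0) :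
    ‖x‖ ≤ 2 * |inner ℝ r x| := by
  -- `K (M x) = 0` forces `M x` to be a multiple of `r`. The coefficient sees only `M x - K x`, so
  -- `K x` is small and the gap bounds the part of `x` orthogonal to `r`.
  have h1 := h.eq_smul_of_apply_eq_zero hg hx
  have h2 : inner ℝ r (M x) = inner ℝ r (M x - K x) := by
    rw [inner_sub_right, h.inner_apply, sub_zero]
  have h3 : K x = (inner ℝ r (M x - K x) : ℝ) • r - (M x - K x) := by
    rw [← h2, ← h1]; abel
  have h4 : ‖K x‖ ≤ g / 2 * ‖x‖ := by
    rw [h3]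
    refine (norm_sub_le _ _).trans ?_
    rw [norm_smul, h.norm_eq, mul_one, Real.norm_eq_abs]
    have h5 := abs_real_inner_le_norm r (M x - K x)
    rw [h.norm_eq, one_mul] at h5
    have := hM x
    linarith
  have h5 := h.bound_sub x
  have h6 : ‖x‖ ≤ ‖x - (inner ℝ r x : ℝ) • r‖ + |inner ℝ r x| := by
    have := norm_add_le (x - (inner ℝ r x : ℝ) • r) ((inner ℝ r x : ℝ) • r)
    rwa [sub_add_cancel, norm_smul, h.norm_eq, mul_one, Real.norm_eq_abs] at this
  have h7 : ‖x - (inner ℝ r x : ℝ) • r‖ ≤ ‖x‖ / 2 := by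
    have : g * ‖x - (inner ℝ r x : ℝ) • r‖ ≤ g * (‖x‖ / 2) := by linarith
    exact le_of_mul_le_mul_left this hg
  linarith

/-- A vector `b` is controlled by `K b` and by `⟨y, b⟩`, when `⟨y, r⟩ = 1`. -/
theorem norm_le_of_inner (h : GappedAt K r g) (hg : 0 < g) {y : V} (hy : inner ℝ y r = (1 : ℝ))
    (b : V) : ‖b‖ ≤ |inner ℝ y b| + (1 + ‖y‖) / g * ‖K b‖ := by
  set b' := b - (inner ℝ y b : ℝ) • r with hb'
  have hKb : K b' = K b := by rw [hb', map_sub, map_smul, h.apply_eq, smul_zero, sub_zero]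
  have h1 := h.bound_sub b'
  set z := b' - (inner ℝ r b' : ℝ) • r with hz
  rw [hKb] at h1
  have hyb : inner ℝ y b' = (0 : ℝ) := by
    rw [hb', inner_sub_right, inner_smul_right, hy, mul_one, sub_self]
  have h2 : |inner ℝ r b'| ≤ ‖y‖ * ‖z‖ := by
    have : inner ℝ y z = -(inner ℝ r b' : ℝ) := by
      rw [hz, inner_sub_right, inner_smul_right, hy, hyb, mul_one, zero_sub]
    rw [← abs_neg, ← this]
    exact abs_real_inner_le_norm y z
  have h3 : ‖b'‖ ≤ ‖z‖ + |inner ℝ r b'| := by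
    have := norm_add_le z ((inner ℝ r b' : ℝ) • r)
    rwa [hz, sub_add_cancel, norm_smul, h.norm_eq, mul_one, Real.norm_eq_abs] at this
  have h4 : ‖b‖ ≤ ‖b'‖ + |inner ℝ y b| := by
    have := norm_add_le b' ((inner ℝ y b : ℝ) • r)
    rwa [hb', sub_add_cancel, norm_smul, h.norm_eq, mul_one, Real.norm_eq_abs] at this
  have h5 : ‖z‖ ≤ ‖K b‖ / g := by rw [le_div_iff₀ hg, mul_comm]; exact h1
  have h6 : (1 + ‖y‖) * ‖z‖ ≤ (1 + ‖y‖) * (‖K b‖ / g) := by gcongr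
  have : (1 + ‖y‖) / g * ‖K b‖ = (1 + ‖y‖) * (‖K b‖ / g) := by ring
  linarith

end GappedAt

variable {ι : Type*} [Fintype ι]

/-- The projections of a non-symmetric operator need not be orthogonal; Cauchy–Schwarz replaces
Parseval at the cost of the factor `card ι`. -/
theorem norm_sq_le_card_mul_sum_spectralProj [DecidableEq ι] [Nonempty ι] (A : V →L[ℝ] V) {μ : ι → ℝ}
    (hμ : Function.Injective μ) (a : V) :
    ‖a‖ ^ 2 ≤ Fintype.card ι * ∑ i, ‖spectralProj A μ i a‖ ^ 2 := by
  have h1 : a = ∑ i, spectralProj A μ i a := by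
    have := congrArg (fun B : V →L[ℝ] V => B a) (sum_spectralProj A hμ)
    simpa using this.symm
  calc ‖a‖ ^ 2 = ‖∑ i, spectralProj A μ i a‖ ^ 2 := by rw [← h1]
    _ ≤ (∑ i, ‖spectralProj A μ i a‖) ^ 2 := by gcongr; exact norm_sum_le _ _
    _ ≤ _ := sq_sum_le_card_mul_sum_sq

/-- Existence of a symmetrizer: quadratic forms `P`, `Q`, which are `C¹` in time, such that
`⟨a, P a⟩ + ⟨b, Q b⟩` is constant along the frozen flow `a' = K b`, `b' = - M a` and positive
definite up to the two neutral directions. -/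
theorem exists_symmetrizer [FiniteDimensional ℝ V] {K M : ℝ → V →L[ℝ] V} {r y : ℝ → V} {g Y : ℝ} (hg : 0 < g)
    (hK : ContDiffAt ℝ 1 K 0) (hM : ContDiffAt ℝ 1 M 0)
    {μ₀ : ι → ℝ} (hμ₀ : Function.Injective μ₀) {j₀ : ι}
    (hpos : ∀ i, i ≠ j₀ → 0 < μ₀ i)
    (hchar : LinearMap.charpoly (K 0 ∘L M 0 : V →L[ℝ] V).toLinearMap
      = Lagrange.nodal Finset.univ μ₀)
    (hgap : ∀ᶠ t in 𝓝 0, GappedAt (K t) (r t) g)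
    (hclose : ∀ᶠ t in 𝓝 0, ∀ x, ‖M t x - K t x‖ ≤ g / 4 * ‖x‖)
    (hy : ∀ᶠ t in 𝓝 0, inner ℝ (y t) (r t) = (1 : ℝ) ∧ ‖y t‖ ≤ Y) :
    ∃ P Q : ℝ → V →L[ℝ] V, ContDiffAt ℝ 1 P 0 ∧ ContDiffAt ℝ 1 Q 0 ∧ ∃ c > 0, ∀ᶠ t in 𝓝 0,
      (∀ a b, inner ℝ (P t a) b = inner ℝ a (P t b)) ∧
      (∀ a b, inner ℝ (Q t a) b = inner ℝ a (Q t b)) ∧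
      (∀ a b, inner ℝ (P t a) (K t b) = inner ℝ (Q t b) (M t a)) ∧
      (∀ a, c * ‖a‖ ^ 2 ≤ inner ℝ (P t a) a + inner ℝ (r t) a ^ 2) ∧
      ∀ b, c * ‖b‖ ^ 2 ≤ inner ℝ (Q t b) b + inner ℝ (y t) b ^ 2 := by
  classical
  have : Nonempty ι := ⟨j₀⟩
  have hA : ContDiffAt ℝ 1 (fun t => K t ∘L M t) 0 := hK.clm_comp hM
  obtain ⟨μ, hμ1, hμ2, hμ3⟩ := exists_contDiffAt_charpoly_eq_nodal hA hμ₀ hchar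
  have hinj : Function.Injective fun i => μ i 0 := by simpa only [hμ2] using hμ₀
  set Pr : ι → ℝ → V →L[ℝ] V := fun i t => spectralProj (K t ∘L M t) (fun j => μ j t) i with hPr
  have hPrC : ∀ i, ContDiffAt ℝ 1 (Pr i) 0 := fun i => contDiffAt_spectralProj hA hμ1 hinj i
  have hadj : ∀ i, ContDiffAt ℝ 1 (fun t => ContinuousLinearMap.adjoint (Pr i t)) 0 := fun i =>
    contDiff_adjoint.contDiffAt.comp (0 : ℝ) (hPrC i)
  set S : ℝ → V →L[ℝ] V := fun t => ∑ i, ContinuousLinearMap.adjoint (Pr i t) ∘L Pr i t with hS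
  have hSC : ContDiffAt ℝ 1 S 0 := ContDiffAt.sum fun i _ => (hadj i).clm_comp (hPrC i)
  obtain ⟨c₁, hc₁, hc₁'⟩ : ∃ c₁ > 0, ∀ i, i ≠ j₀ → c₁ < μ₀ i := by
    by_cases hne : (Finset.univ.erase j₀).Nonempty
    · obtain ⟨k, hk, hmin⟩ := Finset.exists_min_image _ μ₀ hne
      have hk0 := hpos k (Finset.ne_of_mem_erase hk)
      refine ⟨μ₀ k / 2, by positivity, fun i hi => ?_⟩
      have := hmin i (Finset.mem_erase.2 ⟨hi, Finset.mem_univ i⟩)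
      linarith
    · refine ⟨1, one_pos, fun i hi => (hne ⟨i, Finset.mem_erase.2 ⟨hi, Finset.mem_univ i⟩⟩).elim⟩
  have hμpos : ∀ᶠ t in 𝓝 (0 : ℝ), ∀ i, i ≠ j₀ → c₁ ≤ μ i t := by
    refine eventually_all.2 fun i => ?_
    by_cases hi : i = j₀
    · simp [hi]
    · have : c₁ < μ i 0 := by rw [hμ2]; exact hc₁' i hi
      filter_upwards [(hμ1 i).continuousAt.eventually_const_le this] with t ht _ using ht
  -- `S = ∑ Prᵢ* Prᵢ` is a scalar product making `K M` symmetric. The choice `P = ∑ μᵢ Prᵢ* Prᵢ`, `Q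
  -- = K S K` balances the cross terms: both `⟨P a, K b⟩` and `⟨Q b, M a⟩` equal `∑ μᵢ ⟨Prᵢ a, Prᵢ K
  -- b⟩`, because `Prᵢ K M = μᵢ Prᵢ`.
  refine ⟨fun t => ∑ i, μ i t • (ContinuousLinearMap.adjoint (Pr i t) ∘L Pr i t),
    fun t => K t ∘L S t ∘L K t,
    ContDiffAt.sum fun i _ => (hμ1 i).smul ((hadj i).clm_comp (hPrC i)),
    hK.clm_comp (hSC.clm_comp hK), ?_⟩
  set n : ℝ := (Fintype.card ι : ℝ) with hn
  have hn0 : 0 < n := by rw [hn]; exact_mod_cast Fintype.card_pos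
  -- The two entries are the coercivity constants of `P` and of `Q` obtained below.
  refine ⟨min (1 / (n * (1 / c₁ + 4))) (1 / (2 * (1 + ((1 + |Y|) / g) ^ 2 * n))),
    by positivity, ?_⟩
  filter_upwards [hμ3, hμpos, hgap, hclose, hy] with t ⟨hinjt, hchart⟩ hpost hgapt hcloset ⟨hy1, hy2⟩
  have hsymS : ∀ a b, inner ℝ (S t a) b = ∑ i, inner ℝ (Pr i t a) (Pr i t b) := by
    intro a b
    simp [hS, sum_inner, ContinuousLinearMap.adjoint_inner_left]
  have hsymS' : ∀ a b, inner ℝ a (S t b) = ∑ i, inner ℝ (Pr i t a) (Pr i t b) := by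
    intro a b
    simp [hS, inner_sum, ContinuousLinearMap.adjoint_inner_right]
  have hPl : ∀ a b, inner ℝ ((∑ i, μ i t • (ContinuousLinearMap.adjoint (Pr i t) ∘L Pr i t)) a) b
      = ∑ i, μ i t * inner ℝ (Pr i t a) (Pr i t b) := by
    intro a b
    simp [sum_inner, ContinuousLinearMap.adjoint_inner_left,
      inner_smul_left]
  have hPrmul : ∀ i x, K t (M t (Pr i t x)) = μ i t • Pr i t x := by
    intro i x
    exact congrArg (fun B : V →L[ℝ] V => B x) (mul_spectralProj hchart i)
  have hPrmul' : ∀ i x, Pr i t (K t (M t x)) = μ i t • Pr i t x := by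
    intro i x
    rw [← hPrmul]
    exact congrArg (fun B : V →L[ℝ] V => B x)
      (spectralProj_mul_comm (K t ∘L M t) (fun j => μ j t) i).symm
  have hrA : ∀ x, inner ℝ (r t) ((K t ∘L M t) x) = 0 := fun x => hgapt.inner_apply _
  -- The zero eigenvalue persists exactly: `K t` has the kernel vector `r t`, so 0 is a root, and
  -- the other branches stay above `c₁ > 0`.
  have hrdet : μ j₀ t = 0 := by
    have hr0 : r t ≠ 0 := by
      intro h0; have := hgapt.norm_eq; rw [h0, norm_zero] at this; norm_num at this
    have hroot : (Lagrange.nodal Finset.univ fun i => μ i t).eval 0 = 0 := by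
      rw [← hchart, LinearMap.eval_charpoly, map_zero, zero_sub, ← neg_one_smul ℝ,
        LinearMap.det_smul]
      change _ * LinearMap.det ((K t : V →ₗ[ℝ] V) ∘ₗ (M t : V →ₗ[ℝ] V)) = 0
      rw [LinearMap.det_comp]
      have : LinearMap.det (K t : V →ₗ[ℝ] V) = 0 := by
        by_contra hne
        exact hr0 ((LinearMap.equivOfDetNeZero _ hne).injective
          (by simpa using hgapt.apply_eq))
      rw [this]; ring
    rw [Lagrange.eval_nodal, Finset.prod_eq_zero_iff] at hroot
    obtain ⟨i, -, hi⟩ := hroot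
    by_cases hij : i = j₀
    · rw [← hij]; linarith
    · have := hpost i hij
      linarith
  refine ⟨fun a b => ?_, fun a b => ?_, fun a b => ?_, fun a => ?_, fun b => ?_⟩
  · rw [hPl, real_inner_comm, hPl]
    exact Finset.sum_congr rfl fun i _ => by rw [real_inner_comm]
  · simp only [ContinuousLinearMap.comp_apply]
    rw [hgapt.symm, hsymS, ← hgapt.symm, hsymS']
  · simp only [ContinuousLinearMap.comp_apply]
    rw [hPl, hgapt.symm, hsymS]
    refine Finset.sum_congr rfl fun i _ => ?_
    rw [hPrmul', inner_smul_right, real_inner_comm]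
  · have h1 := norm_sq_le_card_mul_sum_spectralProj (K t ∘L M t) hinjt a
    rw [hPl]
    set p := ∑ i, μ i t * inner ℝ (Pr i t a) (Pr i t a) with hp
    have hp1 : p = ∑ i ∈ Finset.univ.erase j₀, μ i t * ‖Pr i t a‖ ^ 2 := by
      rw [hp, ← Finset.add_sum_erase _ _ (Finset.mem_univ j₀), hrdet, zero_mul, zero_add]
      simp only [real_inner_self_eq_norm_sq]
    have hp2 : c₁ * ∑ i ∈ Finset.univ.erase j₀, ‖Pr i t a‖ ^ 2 ≤ p := by
      rw [hp1, Finset.mul_sum]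
      refine Finset.sum_le_sum fun i hi => ?_
      gcongr
      exact hpost i (Finset.ne_of_mem_erase hi)
    -- The only component that `P` misses lies in the kernel of `K M`, near the line of `r`, and has
    -- the same inner product with `r` as `a`.
    have hp3 : ‖Pr j₀ t a‖ ^ 2 ≤ 4 * inner ℝ (r t) a ^ 2 := by
      have h2 := hgapt.norm_le_of_apply_apply_eq_zero hg hcloset (x := Pr j₀ t a)
        (by rw [hPrmul, hrdet, zero_smul])
      rw [inner_spectralProj_of_left_kernel hinjt hrdet hrA] at h2
      calc ‖Pr j₀ t a‖ ^ 2 ≤ (2 * |inner ℝ (r t) a|) ^ 2 := by gcongr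
        _ = _ := by rw [mul_pow, sq_abs]; norm_num
    have h1' : ‖a‖ ^ 2 ≤ n * (‖Pr j₀ t a‖ ^ 2 + ∑ i ∈ Finset.univ.erase j₀, ‖Pr i t a‖ ^ 2) := by
      rw [Finset.add_sum_erase _ (fun i => ‖Pr i t a‖ ^ 2) (Finset.mem_univ j₀)]
      exact h1
    set s := ∑ i ∈ Finset.univ.erase j₀, ‖Pr i t a‖ ^ 2
    have hs : 0 ≤ s := Finset.sum_nonneg fun i _ => by positivity
    have hs' : s ≤ p / c₁ := by rw [le_div_iff₀ hc₁]; linarith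
    have hp0 : 0 ≤ p := le_trans (by positivity) hp2
    have hr0 : 0 ≤ inner ℝ (r t) a ^ 2 := sq_nonneg (inner ℝ (r t) a)
    calc _ ≤ 1 / (n * (1 / c₁ + 4)) * ‖a‖ ^ 2 := by gcongr; exact min_le_left _ _
      _ ≤ 1 / (n * (1 / c₁ + 4)) * (n * (1 / c₁ + 4) * (p + inner ℝ (r t) a ^ 2)) := by
        gcongr
        refine h1'.trans ?_
        rw [mul_assoc]
        gcongr
        have : 0 ≤ 1 / c₁ * inner ℝ (r t) a ^ 2 := by positivity
        have h3 : p / c₁ = 1 / c₁ * p := by ring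
        nlinarith
      _ = _ := by field_simp
  · have h1 := norm_sq_le_card_mul_sum_spectralProj (K t ∘L M t) hinjt (K t b)
    have hQ : inner ℝ ((K t ∘L S t ∘L K t) b) b = ∑ i, ‖Pr i t (K t b)‖ ^ 2 := by
      simp only [ContinuousLinearMap.comp_apply]
      rw [hgapt.symm, hsymS]
      simp only [real_inner_self_eq_norm_sq]
    rw [hQ]
    set q := ∑ i, ‖Pr i t (K t b)‖ ^ 2 with hq
    have hq0 : 0 ≤ q := Finset.sum_nonneg fun i _ => by positivity
    have h2 := hgapt.norm_le_of_inner hg hy1 b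
    set Z := (1 + |Y|) / g with hZ
    have hZ0 : 0 ≤ Z := by positivity
    have h3 : ‖b‖ ≤ |inner ℝ (y t) b| + Z * ‖K t b‖ := by
      refine h2.trans ?_
      have := hy2.trans (le_abs_self Y)
      rw [hZ]
      gcongr
    have h4 : ‖b‖ ^ 2 ≤ 2 * (inner ℝ (y t) b ^ 2 + Z ^ 2 * (n * q)) := by
      calc ‖b‖ ^ 2 ≤ (|inner ℝ (y t) b| + Z * ‖K t b‖) ^ 2 := by gcongr
        _ ≤ 2 * (|inner ℝ (y t) b| ^ 2 + (Z * ‖K t b‖) ^ 2) := add_sq_le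
        _ ≤ _ := by
          rw [sq_abs, mul_pow]
          gcongr
    have hr0 : 0 ≤ inner ℝ (y t) b ^ 2 := sq_nonneg (inner ℝ (y t) b)
    calc _ ≤ 1 / (2 * (1 + Z ^ 2 * n)) * ‖b‖ ^ 2 := by gcongr; exact min_le_right _ _
      _ ≤ 1 / (2 * (1 + Z ^ 2 * n)) * (2 * (1 + Z ^ 2 * n) * (q + inner ℝ (y t) b ^ 2)) := by
        gcongr
        refine h4.trans ?_
        have : 0 ≤ Z ^ 2 * n * inner ℝ (y t) b ^ 2 := by positivity
        nlinarith
      _ = _ := by field_simp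

end Symmetrizer

end NonlinearAdiabatic

namespace NonlinearAdiabatic

open Filter Topology

/-! ### Correction of the forcing and the left null vector -/

section LinearSystems

variable {V : Type*} [NormedAddCommGroup V] [InnerProductSpace ℝ V]

/-- In finite dimension injectivity gives invertibility, and inversion is smooth at invertible
operators. -/
theorem exists_contDiffAt_solution [FiniteDimensional ℝ V] {W : ℝ → V →L[ℝ] V} {f : ℝ → V}
    (hW : ContDiffAt ℝ 1 W 0) (hf : ContDiffAt ℝ 1 f 0)
    (hinj : ∀ᶠ t in 𝓝 0, ∀ x, W t x = 0 → x = 0) :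
    ∃ s : ℝ → V, ContDiffAt ℝ 1 s 0 ∧ ∀ᶠ t in 𝓝 0, W t (s t) = f t := by
  have he : ∀ A : V →L[ℝ] V, (∀ x, A x = 0 → x = 0) →
      ∃ e : V ≃L[ℝ] V, (e : V →L[ℝ] V) = A := fun A hA =>
    ⟨(LinearEquiv.ofInjectiveEndo (A : V →ₗ[ℝ] V)
      (LinearMap.ker_eq_bot.1 (LinearMap.ker_eq_bot'.2 hA))).toContinuousLinearEquiv, by ext; simp⟩
  refine ⟨fun t => (W t).inverse (f t), ?_, ?_⟩
  · obtain ⟨e, he0⟩ := he _ hinj.self_of_nhds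
    have h1 : ContDiffAt ℝ 1 (ContinuousLinearMap.inverse : (V →L[ℝ] V) → V →L[ℝ] V) (W 0) := by
      rw [← he0]; exact contDiffAt_map_inverse e
    exact (h1.comp (0 : ℝ) hW).clm_apply hf
  · filter_upwards [hinj] with t ht
    obtain ⟨e, he0⟩ := he _ ht
    rw [← he0]
    simp

/-- The operator `K` with its kernel filled in and a perturbation `B` compressed to the orthogonal
complement of `r`. -/
noncomputable def filled (K B : V →L[ℝ] V) (r : V) (g : ℝ) : V →L[ℝ] V :=
  K + B - (innerSL ℝ r ∘L B).smulRight r + g • (innerSL ℝ r).smulRight r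

theorem filled_apply (K B : V →L[ℝ] V) (r : V) (g : ℝ) (x : V) :
    filled K B r g x = K x + B x - (inner ℝ r (B x) : ℝ) • r + g • (inner ℝ r x : ℝ) • r := by
  simp [filled]

theorem contDiffAt_filled {K B : ℝ → V →L[ℝ] V} {r : ℝ → V} {g : ℝ} (hK : ContDiffAt ℝ 1 K 0)
    (hB : ContDiffAt ℝ 1 B 0) (hr : ContDiffAt ℝ 1 r 0) :
    ContDiffAt ℝ 1 (fun t => filled (K t) (B t) (r t) g) 0 := by
  have h1 : ContDiffAt ℝ 1 (fun t => innerSL ℝ (r t)) 0 := (innerSL ℝ).contDiff.contDiffAt.comp 0 hr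
  exact ((hK.add hB).sub ((h1.clm_comp hB).smulRight hr)).add
    ((h1.smulRight hr).const_smul g)

variable {K B : V →L[ℝ] V} {r : V} {g : ℝ}

theorem GappedAt.inner_filled (h : GappedAt K r g) (x : V) :
    inner ℝ r (filled K B r g x) = g * inner ℝ r x := by
  rw [filled_apply]
  simp only [inner_add_right, inner_sub_right, inner_smul_right, h.inner_apply, h.inner_self]
  ring

/-- A null vector is orthogonal to `r` by the filling term. There `K` is bounded below by `g`, while
the compressed perturbation costs at most `g / 2`. -/
theorem GappedAt.filled_injective (h : GappedAt K r g) (hg : 0 < g)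
    (hB : ∀ x, ‖B x‖ ≤ g / 4 * ‖x‖) {x : V} (hx : filled K B r g x = 0) : x = 0 := by
  have h1 : inner ℝ r x = (0 : ℝ) := by
    have := h.inner_filled (B := B) x
    rw [hx, inner_zero_right] at this
    exact (mul_eq_zero.1 this.symm).resolve_left hg.ne'
  have h2 : K x = (inner ℝ r (B x) : ℝ) • r - B x := by
    rw [filled_apply, h1] at hx
    simp only [zero_smul, smul_zero, add_zero, sub_eq_zero] at hx
    rw [← hx]; abel
  have h3 : ‖K x‖ ≤ g / 2 * ‖x‖ := by
    rw [h2]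
    refine (norm_sub_le _ _).trans ?_
    rw [norm_smul, h.norm_eq, mul_one, Real.norm_eq_abs]
    have h5 := abs_real_inner_le_norm r (B x)
    rw [h.norm_eq, one_mul] at h5
    have := hB x
    linarith
  have h4 := h.bound x h1
  have h5 := norm_nonneg x
  have : ‖x‖ = 0 := by nlinarith
  exact norm_eq_zero.1 this

/-- When the right-hand side is orthogonal to `r`, so is the solution of the filled system, and the
filling term disappears. -/
theorem exists_contDiffAt_preimage [FiniteDimensional ℝ V] {K : ℝ → V →L[ℝ] V} {r f : ℝ → V} (hg : 0 < g)
    (hK : ContDiffAt ℝ 1 K 0) (hr : ContDiffAt ℝ 1 r 0) (hf : ContDiffAt ℝ 1 f 0)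
    (hgap : ∀ᶠ t in 𝓝 0, GappedAt (K t) (r t) g) (hrf : ∀ᶠ t in 𝓝 0, inner ℝ (r t) (f t) = (0 : ℝ)) :
    ∃ s : ℝ → V, ContDiffAt ℝ 1 s 0 ∧ ∀ᶠ t in 𝓝 0, K t (s t) = f t := by
  obtain ⟨s, hs, hs'⟩ := exists_contDiffAt_solution
    (contDiffAt_filled (B := fun _ => 0) (g := g) hK contDiffAt_const hr) hf (by
      filter_upwards [hgap] with t ht x hx
      exact ht.filled_injective hg (fun x => by simpa using by positivity) hx)
  refine ⟨s, hs, ?_⟩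
  filter_upwards [hs', hgap, hrf] with t h1 h2 h3
  have h4 := h2.inner_filled (B := 0) (s t)
  rw [h1, h3] at h4
  have h5 : inner ℝ (r t) (s t) = (0 : ℝ) := (mul_eq_zero.1 h4.symm).resolve_left hg.ne'
  rw [← h1, filled_apply, h5]
  simp

/-- The left null vector of `M K`, where `M` is a small perturbation of `K`. -/
theorem exists_contDiffAt_left_null [FiniteDimensional ℝ V] {K M : ℝ → V →L[ℝ] V} {r : ℝ → V} (hg : 0 < g)
    (hK : ContDiffAt ℝ 1 K 0) (hM : ContDiffAt ℝ 1 M 0) (hr : ContDiffAt ℝ 1 r 0)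
    (hgap : ∀ᶠ t in 𝓝 0, GappedAt (K t) (r t) g)
    (hclose : ∀ᶠ t in 𝓝 0, ∀ x, ‖M t x - K t x‖ ≤ g / 4 * ‖x‖) :
    ∃ y : ℝ → V, ContDiffAt ℝ 1 y 0 ∧ ∀ᶠ t in 𝓝 0, inner ℝ (y t) (r t) = (1 : ℝ) ∧
      ∀ a, inner ℝ (y t) (M t a) = (inner ℝ (y t) (M t (r t)) * inner ℝ (r t) a : ℝ) := by
  have hB : ContDiffAt ℝ 1 (fun t => ContinuousLinearMap.adjoint (M t - K t)) 0 :=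
    contDiff_adjoint.contDiffAt.comp (0 : ℝ) (hM.sub hK)
  -- With the adjoint of `M - K` as perturbation and right-hand side `g r`, the filled system says
  -- that `⟨r, y⟩ = 1` and that `M* y` is a multiple of `r`.
  obtain ⟨y, hy, hy'⟩ := exists_contDiffAt_solution
    (contDiffAt_filled (g := g) hK hB hr) (hr.const_smul g) (by
      filter_upwards [hgap, hclose] with t ht ht' x hx
      refine ht.filled_injective hg (fun x => ?_) hx
      refine (ContinuousLinearMap.le_opNorm _ x).trans ?_
      gcongr
      rw [LinearIsometryEquiv.norm_map]
      exact ContinuousLinearMap.opNorm_le_bound _ (by positivity) ht')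
  refine ⟨y, hy, ?_⟩
  filter_upwards [hy', hgap] with t h1 h2
  have h3 : inner ℝ (r t) (y t) = (1 : ℝ) := by
    have := h2.inner_filled (B := ContinuousLinearMap.adjoint (M t - K t)) (y t)
    rw [h1, inner_smul_right, h2.inner_self] at this
    exact (mul_left_cancel₀ hg.ne' this).symm
  refine ⟨by rw [real_inner_comm, h3], ?_⟩
  have h4 : ∀ a, inner ℝ (y t) (M t a)
      = (inner ℝ (r t) (ContinuousLinearMap.adjoint (M t - K t) (y t)) * inner ℝ (r t) a : ℝ) := by
    intro a
    rw [filled_apply, h3, one_smul, add_eq_right, sub_eq_zero] at h1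
    have h5 := congrArg (fun z => inner ℝ z a) h1
    simp only [inner_add_left, inner_smul_left, ContinuousLinearMap.adjoint_inner_left,
      sub_apply, inner_sub_right, h2.symm] at h5
    rw [RCLike.conj_to_real] at h5
    linarith
  intro a
  rw [h4 a, h4 (r t), h2.inner_self, mul_one]

end LinearSystems

/-! ### Continuity argument and local bounds -/

section Bootstrap

/-- Continuity argument: a strict bound which reproduces itself holds everywhere. -/
theorem lt_of_bootstrap {f : ℝ → ℝ} {τ R : ℝ} (hf : ContinuousOn f (Ioo (-τ) τ)) (h0 : f 0 < R)
    (hstep : ∀ t, 0 ≤ t → t < τ → (∀ s, |s| ≤ t → f s ≤ R) → ∀ s, |s| ≤ t → f s < R)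
    {s : ℝ} (hs : |s| < τ) : f s < R := by
  by_contra hcon
  let h : ℝ → ℝ := fun t => max (f t) (f (-t))
  have hIcc : ∀ t ∈ Icc 0 |s|, t ∈ Ioo (-τ) τ ∧ -t ∈ Ioo (-τ) τ := by
    intro t ht
    have h1 := ht.1
    have h2 := ht.2
    exact ⟨⟨by linarith, by linarith⟩, ⟨by linarith, by linarith⟩⟩
  have hc : ContinuousOn h (Icc 0 |s|) := by
    refine ContinuousOn.sup (hf.mono fun t ht => (hIcc t ht).1) ?_
    exact hf.comp continuous_neg.continuousOn fun t ht => (hIcc t ht).2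
  have hcl : IsCompact (Icc 0 |s| ∩ h ⁻¹' Ici R) :=
    isCompact_Icc.of_isClosed_subset (hc.preimage_isClosed_of_isClosed isClosed_Icc isClosed_Ici)
      inter_subset_left
  have hne : (Icc 0 |s| ∩ h ⁻¹' Ici R).Nonempty := by
    refine ⟨|s|, ⟨abs_nonneg s, le_rfl⟩, ?_⟩
    rcases abs_choice s with h1 | h1
    · rw [h1]; exact (not_lt.1 hcon).trans (le_max_left _ _)
    · rw [h1]
      refine (not_lt.1 hcon).trans ?_
      convert! le_max_right (f (-s)) (f (- -s)) using 2
      rw [neg_neg]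
  -- First time at which `f` reaches `R` on either side of 0. The value there is exactly `R`, so the
  -- weak bound holds up to `t₁` and `hstep` contradicts equality.
  obtain ⟨t₁, ⟨ht₁, hR⟩, hmin⟩ := hcl.exists_isLeast hne
  have hlt : ∀ t, 0 ≤ t → t < t₁ → h t < R := by
    intro t h1 h2
    by_contra h3
    exact absurd (hmin ⟨⟨h1, h2.le.trans ht₁.2⟩, not_lt.1 h3⟩) (not_le.2 h2)
  have heq : h t₁ = R := by
    have hR0 : h 0 ≤ R := by simp only [h, neg_zero, max_self]; exact h0.le
    obtain ⟨t, ht, hte⟩ := intermediate_value_Icc ht₁.1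
      (hc.mono (Icc_subset_Icc_right ht₁.2)) ⟨hR0, hR⟩
    have : t₁ ≤ t := hmin ⟨⟨ht.1, ht.2.trans ht₁.2⟩, hte.ge⟩
    rwa [le_antisymm ht.2 this] at hte
  have hle : ∀ u, |u| ≤ t₁ → f u ≤ R := by
    intro u hu
    have h1 : h |u| ≤ R := by
      rcases hu.lt_or_eq with h2 | h2
      · exact (hlt _ (abs_nonneg u) h2).le
      · rw [h2, heq]
    rcases abs_choice u with h2 | h2
    · rw [h2] at h1; exact (le_max_left _ _).trans h1
    · rw [h2] at h1
      refine le_trans ?_ h1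
      convert! le_max_right (f (-u)) (f (- -u)) using 2
      rw [neg_neg]
  have hfin := hstep t₁ ht₁.1 (ht₁.2.trans_lt hs) hle
  have habs : |t₁| ≤ t₁ := (abs_of_nonneg ht₁.1).le
  exact absurd heq (max_lt (hfin t₁ habs) (hfin (-t₁) (by rwa [abs_neg]))).ne

/-- Stated for all large `C`, so that one constant can serve several functions at once. -/
theorem eventually_hasDerivAt_and_bound {F : Type*} [NormedAddCommGroup F] [NormedSpace ℝ F]
    {f : ℝ → F} (hf : ContDiffAt ℝ 1 f 0) :
    ∀ᶠ C : ℝ in atTop, ∀ᶠ t in 𝓝 0, HasDerivAt f (deriv f t) t ∧ ‖f t‖ ≤ C ∧ ‖deriv f t‖ ≤ C := by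
  have h1 : ∀ᶠ t in 𝓝 (0 : ℝ), HasDerivAt f (deriv f t) t := by
    filter_upwards [hf.eventually (by simp)] with t ht
    exact (ht.differentiableAt one_ne_zero).hasDerivAt
  have h2 : ContinuousAt (deriv f) 0 := by
    have := (hf.fderiv_right (m := 0) (by simp)).continuousAt
    exact this.clm_apply continuousAt_const
  filter_upwards [eventually_gt_atTop ‖f 0‖, eventually_gt_atTop ‖deriv f 0‖] with C hC1 hC2
  filter_upwards [h1, hf.continuousAt.norm.eventually_le_const hC1,
    h2.norm.eventually_le_const hC2] with t a1 a2 a3 using ⟨a1, a2, a3⟩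

end Bootstrap

end NonlinearAdiabatic

namespace NonlinearAdiabatic

open Filter Topology

/-! ### Energy estimate uniform in `ε` -/

section UniformBound

variable {V : Type*} [NormedAddCommGroup V] [InnerProductSpace ℝ V]

theorem abs_inner_apply_le {A : V →L[ℝ] V} {C α β : ℝ} {a b : V} (hC : 0 ≤ C) (hA : ‖A‖ ≤ C)
    (ha : ‖a‖ ≤ α) (hb : ‖b‖ ≤ β) : |inner ℝ (A a) b| ≤ C * α * β := by
  refine (abs_real_inner_le_norm _ _).trans ?_
  have h1 : ‖A a‖ ≤ C * α := (A.le_opNorm a).trans (by gcongr)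
  have h2 : 0 ≤ α := (norm_nonneg a).trans ha
  gcongr

/-- The derivative of the energy `⟨P a, a⟩ + ⟨Q b, b⟩` along a perturbation of
`ε a' = K b`, `ε b' = - M a`. -/
theorem abs_energy_deriv_le {K M P P' Q Q' : V →L[ℝ] V} {a a' b b' : V} {ε C α β δ₁ δ₂ : ℝ}
    (hε : 0 < ε) (hC : 0 ≤ C)
    (hPs : ∀ a b, inner ℝ (P a) b = inner ℝ a (P b))
    (hQs : ∀ a b, inner ℝ (Q a) b = inner ℝ a (Q b))
    (hPQ : ∀ a b, inner ℝ (P a) (K b) = inner ℝ (Q b) (M a))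
    (hP : ‖P‖ ≤ C) (hP' : ‖P'‖ ≤ C) (hQ : ‖Q‖ ≤ C) (hQ' : ‖Q'‖ ≤ C)
    (ha : ‖a‖ ≤ α) (hb : ‖b‖ ≤ β) (h1 : ‖ε • a' - K b‖ ≤ δ₁) (h2 : ‖ε • b' + M a‖ ≤ δ₂) :
    ε * |(inner ℝ (P a) a' + inner ℝ (P' a + P a') a)
        + (inner ℝ (Q b) b' + inner ℝ (Q' b + Q b') b)|
      ≤ ε * (C * α * α) + ε * (C * β * β) + 2 * (C * α * δ₁) + 2 * (C * β * δ₂) := by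
  -- The terms of order 1, `2 ⟨P a, K b⟩` and `-2 ⟨Q b, M a⟩`, cancel by `hPQ`; only the time
  -- dependence of `P`, `Q` and the defects of the system remain.
  have key : ε * ((inner ℝ (P a) a' + inner ℝ (P' a + P a') a)
        + (inner ℝ (Q b) b' + inner ℝ (Q' b + Q b') b))
      = ε * inner ℝ (P' a) a + ε * inner ℝ (Q' b) b + 2 * inner ℝ (P a) (ε • a' - K b)
        + 2 * inner ℝ (Q b) (ε • b' + M a) := by
    simp only [inner_add_left, inner_add_right, inner_sub_right, inner_smul_right, hPQ]
    rw [hPs a' a, hQs b' b, real_inner_comm (P a) a', real_inner_comm (Q b) b']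
    ring
  have e1 := abs_inner_apply_le hC hP' ha ha
  have e2 := abs_inner_apply_le hC hQ' hb hb
  have e3 := abs_inner_apply_le hC hP ha h1
  have e4 := abs_inner_apply_le hC hQ hb h2
  calc _ = |ε * ((inner ℝ (P a) a' + inner ℝ (P' a + P a') a)
        + (inner ℝ (Q b) b' + inner ℝ (Q' b + Q b') b))| := by rw [abs_mul, abs_of_pos hε]
    _ ≤ ε * |inner ℝ (P' a) a| + ε * |inner ℝ (Q' b) b| + 2 * |inner ℝ (P a) (ε • a' - K b)|
        + 2 * |inner ℝ (Q b) (ε • b' + M a)| := by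
      rw [key]
      refine (abs_add_le _ _).trans (add_le_add ((abs_add_le _ _).trans (add_le_add
        ((abs_add_le _ _).trans (add_le_add ?_ ?_)) ?_)) ?_) <;>
      rw [abs_mul] <;> simp [abs_of_pos hε]
    _ ≤ _ := by gcongr

theorem abs_sub_le_of_hasDerivAt {f f' : ℝ → ℝ} {t B : ℝ}
    (hf : ∀ s, |s| ≤ t → HasDerivAt f (f' s) s) (hB : ∀ s, |s| ≤ t → |f' s| ≤ B) {s : ℝ}
    (hs : |s| ≤ t) : |f s - f 0| ≤ B * |s| := by
  have h := (convex_Icc (-t) t).norm_image_sub_le_of_norm_hasDerivWithin_le (f := f) (f' := f')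
    (C := B) (x := 0) (y := s)
    (fun x hx => (hf x (abs_le.2 hx)).hasDerivWithinAt) (fun x hx => hB x (abs_le.2 hx))
    (by have := (abs_nonneg s).trans hs; exact ⟨by linarith, this⟩) (abs_le.1 hs)
  simpa using h

set_option maxHeartbeats 1000000 in
/-- Smallness of the deviation `a + i b` from the instantaneous eigenvector, uniformly on an
interval of times independent of `ε`. -/
theorem exists_uniform_bound {K M P Q : ℝ → V →L[ℝ] V} {r f y s : ℝ → V} {k : ℝ → ℝ} {c : ℝ}
    (hP : ContDiffAt ℝ 1 P 0) (hQ : ContDiffAt ℝ 1 Q 0) (hy : ContDiffAt ℝ 1 y 0)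
    (hs : ContDiffAt ℝ 1 s 0) (hk : ContinuousAt k 0) (hc : 0 < c)
    (hstr : ∀ᶠ t in 𝓝 0,
      (∀ a b, inner ℝ (P t a) b = inner ℝ a (P t b)) ∧
      (∀ a b, inner ℝ (Q t a) b = inner ℝ a (Q t b)) ∧
      (∀ a b, inner ℝ (P t a) (K t b) = inner ℝ (Q t b) (M t a)) ∧
      (∀ a, c * ‖a‖ ^ 2 ≤ inner ℝ (P t a) a + inner ℝ (r t) a ^ 2) ∧
      ∀ b, c * ‖b‖ ^ 2 ≤ inner ℝ (Q t b) b + inner ℝ (y t) b ^ 2)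
    (hyM : ∀ᶠ t in 𝓝 0, ∀ a, inner ℝ (y t) (M t a) = k t * inner ℝ (r t) a)
    (hKs : ∀ᶠ t in 𝓝 0, K t (s t) = f t)
    {D ρ : ℝ} (hD : 0 ≤ D) (hρ : 0 < ρ) {U : Set ℝ} (hU : U ∈ 𝓝 0) :
    ∃ τ > 0, ∃ L > 0, ∃ ε₀ > 0, (∀ t, |t| < τ → t ∈ U) ∧ ∀ ε, 0 < ε → ε < ε₀ →
      ∀ a a' b b' : ℝ → V, a 0 = 0 → b 0 = 0 →
      (∀ t, |t| < τ → HasDerivAt a (a' t) t ∧ HasDerivAt b (b' t) t) →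
      (∀ t, |t| < τ → ‖a t‖ ≤ ρ → ‖b t‖ ≤ ρ →
        ‖ε • a' t - K t (b t) + ε • f t‖ ≤ D * (‖a t‖ ^ 2 + ‖b t‖ ^ 2) ∧
        ‖ε • b' t + M t (a t)‖ ≤ D * (‖a t‖ ^ 2 + ‖b t‖ ^ 2) ∧
        |inner ℝ (r t) (a t)| ≤ D * (‖a t‖ ^ 2 + ‖b t‖ ^ 2)) →
      ∀ t, |t| < τ → ‖a t‖ ≤ L * ε ∧ ‖b t‖ ≤ L * ε := by
  obtain ⟨C, hCP, hCQ, hCy, hCs, hC1, hCk⟩ := ((eventually_hasDerivAt_and_bound hP).and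
    ((eventually_hasDerivAt_and_bound hQ).and ((eventually_hasDerivAt_and_bound hy).and
    ((eventually_hasDerivAt_and_bound hs).and ((eventually_ge_atTop (1 : ℝ)).and
      (eventually_gt_atTop |k 0|)))))).exists
  have hC0 : 0 < C := by linarith
  have hkC : ∀ᶠ t in 𝓝 0, |k t| ≤ C := hk.abs.eventually_le_const hCk
  obtain ⟨τ₀, hτ₀, hball⟩ := Metric.eventually_nhds_iff.1 (hCP.and (hCQ.and (hCy.and (hCs.and
    (hkC.and (hstr.and (hyM.and (hKs.and hU))))))))
  -- `C ^ 3 + 2 * C ^ 4 + 3` sums the bounds `f1`, `f2`, `f3` below. Half of `L` is kept for `ε s`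
  -- in `b = z + ε s`. Since `L` does not involve `D`, the interval can be shortened afterwards.
  obtain ⟨L, hL1, hL2, hL3⟩ : ∃ L : ℝ, 1 ≤ L ∧ 2 * C + 1 ≤ L ∧
      C ^ 3 + 2 * C ^ 4 + 3 < c * (L / 2) ^ 2 := by
    refine ⟨max (2 * C + 1) (2 * (C ^ 3 + 2 * C ^ 4 + 4) / c + 2), ?_, le_max_left _ _, ?_⟩
    · exact le_trans (by linarith) (le_max_left _ _)
    · set B := C ^ 3 + 2 * C ^ 4 + 4 with hB
      have hB0 : 0 < B := by positivity
      have h1 : B / c + 1 ≤ max (2 * C + 1) (2 * B / c + 2) / 2 := by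
        have := le_max_right (2 * C + 1) (2 * B / c + 2)
        have h2 : 2 * B / c = 2 * (B / c) := by ring
        linarith
      have h2 : 0 < B / c := by positivity
      have h3 : (B / c + 1) ^ 2 ≤ (max (2 * C + 1) (2 * B / c + 2) / 2) ^ 2 := by gcongr
      have h4 : B / c ≤ (B / c + 1) ^ 2 := by nlinarith
      calc C ^ 3 + 2 * C ^ 4 + 3 < B := by rw [hB]; linarith
        _ = c * (B / c) := by field_simp
        _ ≤ _ := by gcongr; exact h4.trans h3
  have hL0 : 0 < L := by linarith
  -- `DE * ε ^ 2` and `DB * ε` bound the growth rates of the energy and of `⟨y, z⟩` while `‖a‖, ‖b‖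
  -- ≤ L * ε`.
  set DE := 5 * C * L ^ 2 + 12 * C * D * L ^ 3 + 4 * C ^ 2 * L with hDE
  set DB := 2 * C * L + 4 * C * D * L ^ 2 + C ^ 2 with hDB
  have hDE0 : 0 < DE := by positivity
  have hDB0 : 0 < DB := by positivity
  -- The interval is short enough to add at most `ε ^ 2` to the energy and `ε / 2` to `⟨y, z⟩`. The
  -- threshold on `ε` keeps `L * ε ≤ ρ` and makes `⟨r, a⟩` at most `ε`.
  refine ⟨min τ₀ (min (1 / DE) (1 / (2 * DB))), by positivity, L, hL0,
    min (ρ / L) (1 / (2 * D * L ^ 2 + 1)), by positivity, ?_, ?_⟩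
  · intro t ht
    exact (hball (by simpa using ht.trans_le (min_le_left _ _))).2.2.2.2.2.2.2.2
  intro ε hε hεε a a' b b' ha0 hb0 hder hrem
  set τ := min τ₀ (min (1 / DE) (1 / (2 * DB))) with hτ
  have hτ1 : τ ≤ τ₀ := min_le_left _ _
  have hτ2 : DE * τ ≤ 1 := by
    have : τ ≤ 1 / DE := (min_le_right _ _).trans (min_le_left _ _)
    rwa [le_div_iff₀ hDE0, mul_comm] at this
  have hτ3 : 2 * DB * τ ≤ 1 := by
    have : τ ≤ 1 / (2 * DB) := (min_le_right _ _).trans (min_le_right _ _)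
    rwa [le_div_iff₀ (by positivity), mul_comm] at this
  have hε1 : L * ε ≤ ρ := by
    have : ε ≤ ρ / L := hεε.le.trans (min_le_left _ _)
    rwa [le_div_iff₀ hL0, mul_comm] at this
  have hε2 : 2 * D * L ^ 2 * ε ≤ 1 := by
    have : ε ≤ 1 / (2 * D * L ^ 2 + 1) := hεε.le.trans (min_le_right _ _)
    rw [le_div_iff₀ (by positivity)] at this
    nlinarith
  have hfacts : ∀ t, |t| < τ → _ := fun t ht =>
    hball (y := t) (by simpa using ht.trans_le hτ1)
  suffices h : ∀ t, |t| < τ → max ‖a t‖ ‖b t‖ < L * ε by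
    intro t ht
    exact ⟨(le_max_left _ _).trans (h t ht).le, (le_max_right _ _).trans (h t ht).le⟩
  intro t ht
  refine lt_of_bootstrap (f := fun t => max ‖a t‖ ‖b t‖) (τ := τ) ?_ ?_ ?_ ht
  · intro u hu
    have := hder u (abs_lt.2 hu)
    exact (this.1.continuousAt.norm.sup this.2.continuousAt.norm).continuousWithinAt
  · simp only [ha0, hb0, norm_zero, max_self]; positivity
  clear ht t
  intro t ht0 htτ hbd
  have ha : ∀ u, |u| ≤ t → ‖a u‖ ≤ L * ε := fun u hu => (le_max_left _ _).trans (hbd u hu)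
  have hb : ∀ u, |u| ≤ t → ‖b u‖ ≤ L * ε := fun u hu => (le_max_right _ _).trans (hbd u hu)
  -- the shifted variable, for which the system is homogeneous to leading order
  set z : ℝ → V := fun u => b u - ε • s u with hz
  have hzb : ∀ u, |u| ≤ t → ‖z u‖ ≤ 2 * L * ε := by
    intro u hu
    obtain ⟨-, -, -, ⟨-, h1, -⟩, -⟩ := hfacts u (hu.trans_lt htτ)
    refine (norm_sub_le _ _).trans ?_
    rw [norm_smul, Real.norm_of_nonneg hε.le]
    have := hb u hu
    nlinarith [mul_le_mul_of_nonneg_left h1 hε.le]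
  have hzd : ∀ u, |u| ≤ t → HasDerivAt z (b' u - ε • deriv s u) u := by
    intro u hu
    obtain ⟨-, -, -, ⟨h1, -, -⟩, -⟩ := hfacts u (hu.trans_lt htτ)
    exact (hder u (hu.trans_lt htτ)).2.sub (h1.const_smul ε)
  have hquad : ∀ u, |u| ≤ t → D * (‖a u‖ ^ 2 + ‖b u‖ ^ 2) ≤ 2 * D * L ^ 2 * ε ^ 2 := by
    intro u hu
    calc D * (‖a u‖ ^ 2 + ‖b u‖ ^ 2) ≤ D * ((L * ε) ^ 2 + (L * ε) ^ 2) := by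
          gcongr
          · exact ha u hu
          · exact hb u hu
      _ = _ := by ring
  have hR1 : ∀ u, |u| ≤ t → ‖ε • a' u - K u (z u)‖ ≤ 2 * D * L ^ 2 * ε ^ 2 := by
    intro u hu
    have h1 := (hrem u (hu.trans_lt htτ) ((ha u hu).trans hε1) ((hb u hu).trans hε1)).1
    obtain ⟨-, -, -, -, -, -, -, h2, -⟩ := hfacts u (hu.trans_lt htτ)
    refine le_trans (le_of_eq ?_) (h1.trans (hquad u hu))
    congr 1
    simp only [hz, map_sub, map_smul, h2]
    abel
  have hR2 : ∀ u, |u| ≤ t →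
      ‖ε • (b' u - ε • deriv s u) + M u (a u)‖ ≤ 2 * D * L ^ 2 * ε ^ 2 + C * ε ^ 2 := by
    intro u hu
    have h1 := (hrem u (hu.trans_lt htτ) ((ha u hu).trans hε1) ((hb u hu).trans hε1)).2.1
    obtain ⟨-, -, -, ⟨-, -, h2⟩, -⟩ := hfacts u (hu.trans_lt htτ)
    calc ‖ε • (b' u - ε • deriv s u) + M u (a u)‖
        = ‖(ε • b' u + M u (a u)) - (ε ^ 2) • deriv s u‖ := by congr 1; module
      _ ≤ _ := by
        refine (norm_sub_le _ _).trans (add_le_add (h1.trans (hquad u hu)) ?_)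
        rw [norm_smul, Real.norm_of_nonneg (by positivity), mul_comm]
        gcongr
  have hr : ∀ u, |u| ≤ t → |inner ℝ (r u) (a u)| ≤ 2 * D * L ^ 2 * ε ^ 2 := fun u hu =>
    (hrem u (hu.trans_lt htτ) ((ha u hu).trans hε1) ((hb u hu).trans hε1)).2.2.trans (hquad u hu)
  have hE : ∀ u, |u| ≤ t →
      |(inner ℝ (P u (a u)) (a u) + inner ℝ (Q u (z u)) (z u))
        - (inner ℝ (P 0 (a 0)) (a 0) + inner ℝ (Q 0 (z 0)) (z 0))| ≤ DE * ε ^ 2 * |u| := by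
    intro u hu
    refine abs_sub_le_of_hasDerivAt
      (f := fun u => inner ℝ (P u (a u)) (a u) + inner ℝ (Q u (z u)) (z u))
      (f' := fun u => (inner ℝ (P u (a u)) (a' u)
          + inner ℝ (deriv P u (a u) + P u (a' u)) (a u))
        + (inner ℝ (Q u (z u)) (b' u - ε • deriv s u)
          + inner ℝ (deriv Q u (z u) + Q u (b' u - ε • deriv s u)) (z u))) (t := t) ?_ ?_ hu
    · intro u hu
      obtain ⟨⟨h1, -, -⟩, ⟨h2, -, -⟩, -⟩ := hfacts u (hu.trans_lt htτ)
      have h3 := (hder u (hu.trans_lt htτ)).1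
      exact ((h1.clm_apply h3).inner ℝ h3).add ((h2.clm_apply (hzd u hu)).inner ℝ (hzd u hu))
    · intro u hu
      obtain ⟨⟨-, p1, p2⟩, ⟨-, q1, q2⟩, -, -, -, ⟨s1, s2, s3, -, -⟩, -⟩ :=
        hfacts u (hu.trans_lt htτ)
      have := abs_energy_deriv_le hε hC0.le s1 s2 s3 p1 p2 q1 q2 (ha u hu) (hzb u hu)
        (hR1 u hu) (hR2 u hu)
      refine le_of_mul_le_mul_left (this.trans (le_of_eq ?_)) hε
      rw [hDE]; ring
  have hβ : ∀ u, |u| ≤ t →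
      |inner ℝ (y u) (z u) - inner ℝ (y 0) (z 0)| ≤ DB * ε * |u| := by
    intro u hu
    refine abs_sub_le_of_hasDerivAt
      (f := fun u => inner ℝ (y u) (z u))
      (f' := fun u => inner ℝ (y u) (b' u - ε • deriv s u) + inner ℝ (deriv y u) (z u))
      (t := t) ?_ ?_ hu
    · intro u hu
      obtain ⟨-, -, ⟨h1, -, -⟩, -⟩ := hfacts u (hu.trans_lt htτ)
      exact h1.inner ℝ (hzd u hu)
    · intro u hu
      obtain ⟨-, -, ⟨-, y1, y2⟩, -, k1, -, m1, -⟩ := hfacts u (hu.trans_lt htτ)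
      -- The apparently dominant term `⟨y, M a⟩` is `k ⟨r, a⟩`, hence of order `ε ^ 2` by the
      -- constraint on `⟨r, a⟩`.
      have key : ε * (inner ℝ (y u) (b' u - ε • deriv s u) + inner ℝ (deriv y u) (z u))
          = inner ℝ (y u) (ε • (b' u - ε • deriv s u) + M u (a u))
            - k u * inner ℝ (r u) (a u) + ε * inner ℝ (deriv y u) (z u) := by
        rw [inner_add_right, m1, inner_smul_right]; ring
      have e1 : |inner ℝ (y u) (ε • (b' u - ε • deriv s u) + M u (a u))|
          ≤ C * (2 * D * L ^ 2 * ε ^ 2 + C * ε ^ 2) :=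
        (abs_real_inner_le_norm _ _).trans (mul_le_mul y1 (hR2 u hu) (norm_nonneg _) hC0.le)
      have e2 : |k u * inner ℝ (r u) (a u)| ≤ C * (2 * D * L ^ 2 * ε ^ 2) := by
        rw [abs_mul]
        exact mul_le_mul k1 (hr u hu) (abs_nonneg _) hC0.le
      have e3 : |ε * inner ℝ (deriv y u) (z u)| ≤ ε * (C * (2 * L * ε)) := by
        rw [abs_mul, abs_of_pos hε]
        exact mul_le_mul_of_nonneg_left ((abs_real_inner_le_norm _ _).trans
          (mul_le_mul y2 (hzb u hu) (norm_nonneg _) hC0.le)) hε.le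
      refine le_of_mul_le_mul_left ?_ hε
      calc ε * |inner ℝ (y u) (b' u - ε • deriv s u) + inner ℝ (deriv y u) (z u)|
          = |ε * (inner ℝ (y u) (b' u - ε • deriv s u) + inner ℝ (deriv y u) (z u))| := by
            rw [abs_mul, abs_of_pos hε]
        _ ≤ C * (2 * D * L ^ 2 * ε ^ 2 + C * ε ^ 2) + C * (2 * D * L ^ 2 * ε ^ 2)
            + ε * (C * (2 * L * ε)) := by
          rw [key]
          exact (abs_add_le _ _).trans (add_le_add ((abs_sub _ _).trans (add_le_add e1 e2)) e3)
        _ = _ := by rw [hDB]; ring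
  have h00 : |(0 : ℝ)| < τ := by rw [abs_zero]; positivity
  have hz0 : ‖z 0‖ ≤ C * ε := by
    obtain ⟨-, -, -, ⟨-, h1, -⟩, -⟩ := hfacts 0 h00
    simp only [hz, hb0, zero_sub, norm_neg, norm_smul, Real.norm_of_nonneg hε.le]
    nlinarith
  have hE0 : inner ℝ (P 0 (a 0)) (a 0) + inner ℝ (Q 0 (z 0)) (z 0) ≤ C ^ 3 * ε ^ 2 := by
    obtain ⟨-, ⟨-, q1, -⟩, -⟩ := hfacts 0 h00
    rw [ha0, inner_zero_right, zero_add]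
    refine (le_abs_self _).trans ((abs_inner_apply_le hC0.le q1 hz0 hz0).trans (le_of_eq ?_))
    ring
  have hβ0 : |inner ℝ (y 0) (z 0)| ≤ C ^ 2 * ε := by
    obtain ⟨-, -, ⟨-, y1, -⟩, -⟩ := hfacts 0 h00
    refine (abs_real_inner_le_norm _ _).trans ((mul_le_mul y1 hz0 (norm_nonneg _)
      hC0.le).trans (le_of_eq ?_))
    ring
  intro u hu
  have huτ := hu.trans_lt htτ
  obtain ⟨-, -, -, ⟨-, s1, -⟩, -, ⟨-, -, -, p1, q1⟩, -⟩ := hfacts u huτ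
  have f1 : inner ℝ (P u (a u)) (a u) + inner ℝ (Q u (z u)) (z u) ≤ (C ^ 3 + 1) * ε ^ 2 := by
    have h1 := (le_abs_self _).trans (hE u hu)
    have h2 : DE * ε ^ 2 * |u| ≤ ε ^ 2 := by
      calc DE * ε ^ 2 * |u| ≤ DE * ε ^ 2 * τ := by gcongr
        _ = DE * τ * ε ^ 2 := by ring
        _ ≤ 1 * ε ^ 2 := by gcongr
        _ = _ := one_mul _
    linarith
  have f2 : inner ℝ (y u) (z u) ^ 2 ≤ (2 * C ^ 4 + 1) * ε ^ 2 := by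
    have h1 : |inner ℝ (y u) (z u)| ≤ C ^ 2 * ε + ε / 2 := by
      have h2 : DB * ε * |u| ≤ ε / 2 := by
        calc DB * ε * |u| ≤ DB * ε * τ := by gcongr
          _ = (2 * DB * τ) * ε / 2 := by ring
          _ ≤ 1 * ε / 2 := by gcongr
          _ = _ := by rw [one_mul]
      have h3 := abs_sub_abs_le_abs_sub (inner ℝ (y u) (z u)) (inner ℝ (y 0) (z 0))
      have h4 := hβ u hu
      linarith
    calc inner ℝ (y u) (z u) ^ 2 = |inner ℝ (y u) (z u)| ^ 2 := (sq_abs _).symm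
      _ ≤ (C ^ 2 * ε + ε / 2) ^ 2 := by gcongr
      _ ≤ 2 * ((C ^ 2 * ε) ^ 2 + (ε / 2) ^ 2) := add_sq_le
      _ ≤ _ := by nlinarith [sq_nonneg ε]
  have f3 : inner ℝ (r u) (a u) ^ 2 ≤ ε ^ 2 := by
    have h1 : |inner ℝ (r u) (a u)| ≤ ε := by
      calc _ ≤ 2 * D * L ^ 2 * ε ^ 2 := hr u hu
        _ = (2 * D * L ^ 2 * ε) * ε := by ring
        _ ≤ 1 * ε := by gcongr
        _ = ε := one_mul ε
    rw [← sq_abs]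
    gcongr
  have f4 : c * (‖a u‖ ^ 2 + ‖z u‖ ^ 2) < c * (L / 2 * ε) ^ 2 := by
    have h1 := p1 (a u)
    have h2 := q1 (z u)
    calc c * (‖a u‖ ^ 2 + ‖z u‖ ^ 2) ≤ (C ^ 3 + 2 * C ^ 4 + 3) * ε ^ 2 := by linarith
      _ < (c * (L / 2) ^ 2) * ε ^ 2 := by gcongr
      _ = _ := by ring
  have f5 := lt_of_mul_lt_mul_left f4 hc.le
  have hLε : 0 ≤ L / 2 * ε := by positivity
  have f6 : ‖a u‖ < L / 2 * ε := by
    refine lt_of_pow_lt_pow_left₀ 2 hLε ?_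
    have := sq_nonneg ‖z u‖
    linarith
  have f7 : ‖z u‖ < L / 2 * ε := by
    refine lt_of_pow_lt_pow_left₀ 2 hLε ?_
    have := sq_nonneg ‖a u‖
    linarith
  have f8 : ‖b u‖ < L * ε := by
    have h1 : b u = z u + ε • s u := by simp [hz]
    rw [h1]
    refine (norm_add_le _ _).trans_lt ?_
    rw [norm_smul, Real.norm_of_nonneg hε.le]
    have : ε * ‖s u‖ ≤ ε * C := by gcongr
    nlinarith
  exact max_lt (by nlinarith) f8

end UniformBound

end NonlinearAdiabatic

namespace NonlinearAdiabatic

open Filter Topology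

/-! ### The real adiabatic estimate from the gap structure -/

section Gapped

variable {ι V : Type*} [Fintype ι] [NormedAddCommGroup V] [InnerProductSpace ℝ V]

/-- The null vector `r` is orthogonal to every `e i` with `i ≠ j₀`, so it spans the line of `e j₀`;
vectors orthogonal to `r` have components only where `|κ j| ≥ g`. -/
theorem gappedAt_of_eigenbasis (e : OrthonormalBasis ι ℝ V) {κ : ι → ℝ} {K : V →L[ℝ] V}
    (hK : ∀ j, K (e j) = κ j • e j) {j₀ : ι} {g : ℝ} (hg : 0 < g)
    (hgap : ∀ j, j ≠ j₀ → g ≤ |κ j|) (hsymm : ∀ x y, inner ℝ (K x) y = inner ℝ x (K y)) {r : V}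
    (hr : ‖r‖ = 1) (hKr : K r = 0) : GappedAt K r g := by
  refine ⟨hsymm, hKr, hr, fun x hx => ?_⟩
  refine le_norm_apply_of_eigenbasis e hK hg.le fun j hj => ?_
  refine hgap j ?_
  rintro rfl
  have h0 : ∀ i, i ≠ j → inner ℝ (e i) r = (0 : ℝ) := by
    intro i hi
    have h1 : inner ℝ (K (e i)) r = (0 : ℝ) := by rw [hsymm, hKr, inner_zero_right]
    rw [hK, inner_smul_left] at h1
    refine (mul_eq_zero.1 h1).resolve_left fun h2 => ?_
    have h3 := hgap i hi
    rw [show κ i = 0 from h2, abs_zero] at h3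
    linarith
  have h1 : r = (inner ℝ (e j) r : ℝ) • e j := by
    classical
    conv_lhs => rw [← e.sum_repr' r]
    exact Finset.sum_eq_single j (fun i _ hi => by rw [h0 i hi, zero_smul]) (by simp)
  have h2 : (inner ℝ (e j) r : ℝ) * inner ℝ (e j) x = 0 := by
    have : inner ℝ ((inner ℝ (e j) r : ℝ) • e j) x = (0 : ℝ) := by rw [← h1]; exact hx
    rwa [inner_smul_left] at this
  rcases mul_eq_zero.1 h2 with h3 | h3
  · rw [h3, zero_smul] at h1
    rw [h1, norm_zero] at hr
    exact zero_ne_one hr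
  · exact hj h3

/-- The nonlinear adiabatic estimate in real form: deviations `a + i b` from the instantaneous
eigenvector `r` which solve `ε a' = K b - ε r'`, `ε b' = - M a` up to quadratic errors are of
order `ε`. -/
theorem exists_uniform_bound_of_gappedAt [FiniteDimensional ℝ V] {K M : ℝ → V →L[ℝ] V} {r : ℝ → V}
    {g : ℝ} (hg : 0 < g) (hK : ContDiffAt ℝ 1 K 0) (hM : ContDiffAt ℝ 1 M 0)
    (hr : ContDiffAt ℝ 2 r 0) {μ₀ : ι → ℝ} (hμ₀ : Function.Injective μ₀) {j₀ : ι}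
    (hpos : ∀ i, i ≠ j₀ → 0 < μ₀ i)
    (hchar : LinearMap.charpoly (K 0 ∘L M 0 : V →L[ℝ] V).toLinearMap
      = Lagrange.nodal Finset.univ μ₀)
    (hgap : ∀ᶠ t in 𝓝 0, GappedAt (K t) (r t) g)
    (hclose : ∀ᶠ t in 𝓝 0, ∀ x, ‖M t x - K t x‖ ≤ g / 4 * ‖x‖)
    {D ρ : ℝ} (hD : 0 ≤ D) (hρ : 0 < ρ) {U : Set ℝ} (hU : U ∈ 𝓝 0) :
    ∃ τ > 0, ∃ L > 0, ∃ ε₀ > 0, (∀ t, |t| < τ → t ∈ U) ∧ ∀ ε, 0 < ε → ε < ε₀ →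
      ∀ a a' b b' : ℝ → V, a 0 = 0 → b 0 = 0 →
      (∀ t, |t| < τ → HasDerivAt a (a' t) t ∧ HasDerivAt b (b' t) t) →
      (∀ t, |t| < τ → ‖a t‖ ≤ ρ → ‖b t‖ ≤ ρ →
        ‖ε • a' t - K t (b t) + ε • deriv r t‖ ≤ D * (‖a t‖ ^ 2 + ‖b t‖ ^ 2) ∧
        ‖ε • b' t + M t (a t)‖ ≤ D * (‖a t‖ ^ 2 + ‖b t‖ ^ 2) ∧
        |inner ℝ (r t) (a t)| ≤ D * (‖a t‖ ^ 2 + ‖b t‖ ^ 2)) →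
      ∀ t, |t| < τ → ‖a t‖ ≤ L * ε ∧ ‖b t‖ ≤ L * ε := by
  have hr1 : ContDiffAt ℝ 1 r 0 := hr.of_le one_le_two
  have hr' : ContDiffAt ℝ 1 (deriv r) 0 := by
    have : ContDiffAt ℝ 1 (fderiv ℝ r) 0 := hr.fderiv_right (by norm_num)
    exact this.clm_apply contDiffAt_const
  -- Differentiating `‖r‖ ^ 2 = 1` gives the solvability condition for `K s = r'`.
  have hperp : ∀ᶠ t in 𝓝 0, inner ℝ (r t) (deriv r t) = (0 : ℝ) := by
    have h1 : (fun t => ‖r t‖ ^ 2) =ᶠ[𝓝 0] fun _ => 1 := by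
      filter_upwards [hgap] with t ht
      rw [ht.norm_eq, one_pow]
    filter_upwards [h1.eventuallyEq_nhds, hr1.eventually (by simp)] with t ht hd
    have h2 := (hd.differentiableAt one_ne_zero).hasDerivAt.norm_sq
    have h3 := h2.unique ((hasDerivAt_const t (1 : ℝ)).congr_of_eventuallyEq ht)
    linarith
  obtain ⟨s, hs, hKs⟩ := exists_contDiffAt_preimage hg hK hr1 hr' hgap hperp
  obtain ⟨y, hy, hy'⟩ := exists_contDiffAt_left_null hg hK hM hr1 hgap hclose
  have hyb : ∀ᶠ t in 𝓝 0, ‖y t‖ ≤ ‖y 0‖ + 1 :=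
    hy.continuousAt.norm.eventually_le_const (lt_add_one _)
  obtain ⟨P, Q, hP, hQ, c, hc, hstr⟩ := exists_symmetrizer (y := y) hg hK hM hμ₀ hpos hchar hgap
    hclose (by filter_upwards [hy', hyb] with t h1 h2 using ⟨h1.1, h2⟩)
  exact exists_uniform_bound (k := fun t => inner ℝ (y t) (M t (r t))) hP hQ hy hs
    (hy.continuousAt.inner (hM.continuousAt.clm_apply hr1.continuousAt)) hc hstr
    (hy'.mono fun t ht => ht.2) hKs hD hρ hU

end Gapped

end NonlinearAdiabatic

namespace NonlinearAdiabatic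

open Filter Topology

/-! ### Real and imaginary parts, and the real gauge -/

section RealStructure

variable {N p : ℕ}

/-- The inclusion of `ℝ^N` in `ℂ^N`. -/
noncomputable def ofRealVec : EuclideanSpace ℝ (Fin N) →L[ℝ] EuclideanSpace ℂ (Fin N) :=
  LinearMap.toContinuousLinearMap
    { toFun := fun x => WithLp.toLp 2 fun i => (x i : ℂ)
      map_add' := fun x y => by ext; simp
      map_smul' := fun c x => by ext; simp }

/-- The real part of a vector of `ℂ^N`. -/
noncomputable def reVec : EuclideanSpace ℂ (Fin N) →L[ℝ] EuclideanSpace ℝ (Fin N) :=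
  LinearMap.toContinuousLinearMap
    { toFun := fun z => WithLp.toLp 2 fun i => (z i).re
      map_add' := fun x y => by ext; simp
      map_smul' := fun c x => by ext; simp }

/-- The imaginary part of a vector of `ℂ^N`. -/
noncomputable def imVec : EuclideanSpace ℂ (Fin N) →L[ℝ] EuclideanSpace ℝ (Fin N) :=
  LinearMap.toContinuousLinearMap
    { toFun := fun z => WithLp.toLp 2 fun i => (z i).im
      map_add' := fun x y => by ext; simp
      map_smul' := fun c x => by ext; simp }

@[simp] theorem ofRealVec_apply (x : EuclideanSpace ℝ (Fin N)) (i : Fin N) :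
    ofRealVec x i = (x i : ℂ) := rfl

@[simp] theorem reVec_apply (z : EuclideanSpace ℂ (Fin N)) (i : Fin N) :
    reVec z i = (z i).re := rfl

@[simp] theorem imVec_apply (z : EuclideanSpace ℂ (Fin N)) (i : Fin N) :
    imVec z i = (z i).im := rfl

@[simp] theorem reVec_ofRealVec (x : EuclideanSpace ℝ (Fin N)) : reVec (ofRealVec x) = x := by
  ext; simp

@[simp] theorem imVec_ofRealVec (x : EuclideanSpace ℝ (Fin N)) : imVec (ofRealVec x) = 0 := by
  ext; simp

@[simp] theorem reVec_I_smul (z : EuclideanSpace ℂ (Fin N)) :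
    reVec (Complex.I • z) = -imVec z := by
  ext; simp

@[simp] theorem imVec_I_smul (z : EuclideanSpace ℂ (Fin N)) : imVec (Complex.I • z) = reVec z := by
  ext; simp

theorem ofRealVec_add_I_smul (z : EuclideanSpace ℂ (Fin N)) :
    ofRealVec (reVec z) + Complex.I • ofRealVec (imVec z) = z := by
  ext i
  simp [mul_comm Complex.I, Complex.re_add_im]

theorem norm_sq_eq_reVec_add_imVec (z : EuclideanSpace ℂ (Fin N)) :
    ‖z‖ ^ 2 = ‖reVec z‖ ^ 2 + ‖imVec z‖ ^ 2 := by
  simp only [EuclideanSpace.norm_sq_eq, ← Finset.sum_add_distrib]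
  refine Finset.sum_congr rfl fun i _ => ?_
  rw [Complex.sq_norm, Complex.normSq_apply]
  simp [sq]

theorem norm_reVec_le (z : EuclideanSpace ℂ (Fin N)) : ‖reVec z‖ ≤ ‖z‖ := by
  have := norm_sq_eq_reVec_add_imVec z
  exact le_of_sq_le_sq (by nlinarith [sq_nonneg ‖imVec z‖]) (norm_nonneg z)

@[simp] theorem norm_ofRealVec (x : EuclideanSpace ℝ (Fin N)) : ‖ofRealVec x‖ = ‖x‖ := by
  have := norm_sq_eq_reVec_add_imVec (ofRealVec x)
  rw [reVec_ofRealVec, imVec_ofRealVec, norm_zero] at this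
  exact (pow_left_inj₀ (norm_nonneg _) (norm_nonneg _) two_ne_zero).1 (by linarith)

theorem norm_le_reVec_add_imVec (z : EuclideanSpace ℂ (Fin N)) :
    ‖z‖ ≤ ‖reVec z‖ + ‖imVec z‖ := by
  conv_lhs => rw [← ofRealVec_add_I_smul z]
  refine (norm_add_le _ _).trans ?_
  simp [norm_smul]

theorem inner_ofRealVec (x y : EuclideanSpace ℝ (Fin N)) :
    inner ℂ (ofRealVec x) (ofRealVec y) = ((inner ℝ x y : ℝ) : ℂ) := by
  simp [PiLp.inner_apply]

/-- The real operator induced by the real part of an operator on `ℂ^N`. -/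
noncomputable def reOp :
    Op N →L[ℝ] (EuclideanSpace ℝ (Fin N) →L[ℝ] EuclideanSpace ℝ (Fin N)) :=
  LinearMap.toContinuousLinearMap
    { toFun := fun A => reVec ∘L (A.restrictScalars ℝ) ∘L ofRealVec
      map_add' := fun A B => by ext; simp
      map_smul' := fun c A => by ext; simp }

theorem reOp_apply (A : Op N) (x : EuclideanSpace ℝ (Fin N)) :
    reOp A x = reVec (A (ofRealVec x)) := rfl

theorem norm_reOp_apply_le (A : Op N) (x : EuclideanSpace ℝ (Fin N)) :
    ‖reOp A x‖ ≤ ‖A‖ * ‖x‖ := by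
  rw [reOp_apply]
  refine (norm_reVec_le _).trans ((A.le_opNorm _).trans ?_)
  rw [norm_ofRealVec]

theorem IsRealOp.apply_ofRealVec {A : Op N} (hA : IsRealOp A) (x : EuclideanSpace ℝ (Fin N)) :
    A (ofRealVec x) = ofRealVec (reOp A x) := by
  have h1 : conjVec (ofRealVec x) = ofRealVec x := by ext i; simp [conjVec]
  have h2 := hA (ofRealVec x)
  rw [h1] at h2
  have h3 : imVec (A (ofRealVec x)) = 0 := by
    ext i
    have := congrArg (fun z : EuclideanSpace ℂ (Fin N) => (z i).im) h2
    simp only [conjVec, RCLike.star_def, Complex.conj_im] at this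
    simp only [imVec_apply, PiLp.zero_apply]
    linarith
  have h4 := ofRealVec_add_I_smul (A (ofRealVec x))
  rw [h3, map_zero, smul_zero, add_zero] at h4
  rw [reOp_apply, h4]

theorem IsRealOp.apply_eq {A : Op N} (hA : IsRealOp A) (z : EuclideanSpace ℂ (Fin N)) :
    A z = ofRealVec (reOp A (reVec z)) + Complex.I • ofRealVec (reOp A (imVec z)) := by
  conv_lhs => rw [← ofRealVec_add_I_smul z]
  rw [map_add, map_smul, hA.apply_ofRealVec, hA.apply_ofRealVec]

theorem IsRealOp.reVec_apply {A : Op N} (hA : IsRealOp A) (z : EuclideanSpace ℂ (Fin N)) :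
    reVec (A z) = reOp A (reVec z) := by
  rw [hA.apply_eq z]; simp

theorem IsRealOp.imVec_apply {A : Op N} (hA : IsRealOp A) (z : EuclideanSpace ℂ (Fin N)) :
    imVec (A z) = reOp A (imVec z) := by
  rw [hA.apply_eq z]; simp

theorem reOp_symm {A : Op N} (hs : IsSelfAdjoint A) (hA : IsRealOp A)
    (x y : EuclideanSpace ℝ (Fin N)) : inner ℝ (reOp A x) y = inner ℝ x (reOp A y) := by
  have h := ContinuousLinearMap.isSelfAdjoint_iff_isSymmetric.1 hs (ofRealVec x) (ofRealVec y)
  simp only [ContinuousLinearMap.coe_coe, hA.apply_ofRealVec, inner_ofRealVec] at h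
  exact_mod_cast h

theorem exists_apply_eq_smul_of_mem_spectrum {A : Op N} {z : ℂ} (hz : z ∈ spectrum ℂ A) :
    ∃ x, x ≠ 0 ∧ A x = z • x := by
  by_contra! hcon
  refine hz ?_
  rw [spectrum.mem_resolventSet_iff, ContinuousLinearMap.isUnit_iff_bijective]
  have hinj : Function.Injective (algebraMap ℂ (Op N) z - A : Op N) := by
    refine (injective_iff_map_eq_zero _).2 fun x hx => ?_
    by_contra hx0
    refine hcon x hx0 ?_
    rw [sub_apply, sub_eq_zero, Algebra.algebraMap_eq_smul_one] at hx
    simpa using hx.symm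
  let L : EuclideanSpace ℂ (Fin N) →ₗ[ℂ] EuclideanSpace ℂ (Fin N) :=
    (algebraMap ℂ (Op N) z - A : Op N).toLinearMap
  exact ⟨hinj, LinearMap.injective_iff_surjective.1 (show Function.Injective L from hinj)⟩

/-- A real self-adjoint operator with `N` distinct eigenvalues has a real orthonormal
eigenbasis. -/
theorem exists_real_eigenbasis {A : Op N} (hs : IsSelfAdjoint A) (hA : IsRealOp A) {l : Fin N → ℝ}
    (hl : Function.Injective l) (hspec : spectrum ℂ A = range fun j => (l j : ℂ)) :
    ∃ e : OrthonormalBasis (Fin N) ℝ (EuclideanSpace ℝ (Fin N)),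
      ∀ j, reOp A (e j) = l j • e j := by
  have hex : ∀ j, ∃ x : EuclideanSpace ℝ (Fin N), ‖x‖ = 1 ∧ reOp A x = l j • x := by
    intro j
    obtain ⟨z, hz0, hz⟩ := exists_apply_eq_smul_of_mem_spectrum (A := A) (z := (l j : ℂ))
      (by rw [hspec]; exact ⟨j, rfl⟩)
    have hz' : A z = l j • z := by rw [hz]; rfl
    have hre : reOp A (reVec z) = l j • reVec z := by
      rw [← hA.reVec_apply, hz', map_smul]
    have him : reOp A (imVec z) = l j • imVec z := by
      rw [← hA.imVec_apply, hz', map_smul]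
    have hnorm : ∀ x : EuclideanSpace ℝ (Fin N), x ≠ 0 → reOp A x = l j • x →
        ∃ x : EuclideanSpace ℝ (Fin N), ‖x‖ = 1 ∧ reOp A x = l j • x := by
      intro x hx h
      refine ⟨‖x‖⁻¹ • x, ?_, by rw [map_smul, h, smul_comm]⟩
      rw [norm_smul, norm_inv, norm_norm, inv_mul_cancel₀ (norm_ne_zero_iff.2 hx)]
    -- Operator and eigenvalue being real, the real and imaginary parts of `z` both satisfy the
    -- eigenvalue equation; one of them is nonzero.
    by_cases h0 : reVec z = 0
    · refine hnorm _ (fun h1 => hz0 ?_) him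
      rw [← ofRealVec_add_I_smul z, h0, h1]; simp
    · exact hnorm _ h0 hre
  choose x hx1 hx2 using hex
  have hon : Orthonormal ℝ x := by
    refine ⟨hx1, fun i j hij => ?_⟩
    have h := reOp_symm hs hA (x i) (x j)
    rw [hx2, hx2, inner_smul_left, inner_smul_right, RCLike.conj_to_real] at h
    have h2 : (l i - l j) * inner ℝ (x i) (x j) = 0 := by linarith
    exact (mul_eq_zero.1 h2).resolve_left (sub_ne_zero.2 (hl.ne hij))
  refine ⟨OrthonormalBasis.mk hon
    (hon.linearIndependent.span_eq_top_of_card_eq_finrank' (by simp)).ge, fun j => ?_⟩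
  simp [hx2]

theorem occ_smul_of_norm_eq_one {hp : p ≤ N} {c : ℂ} (hc : ‖c‖ = 1)
    (v : EuclideanSpace ℂ (Fin N)) : occ hp (c • v) = occ hp v := by
  ext k
  simp [occ, hc]

theorem occ_apply {hp : p ≤ N} (v : EuclideanSpace ℂ (Fin N)) (k : Fin p) :
    occ hp v k = reVec v (Fin.castLE hp k) ^ 2 + imVec v (Fin.castLE hp k) ^ 2 := by
  simp only [occ, Complex.sq_norm, Complex.normSq_apply]
  simp [sq]

theorem occ_mem_Icc {hp : p ≤ N} {v : EuclideanSpace ℂ (Fin N)} (hv : ‖v‖ = 1) (k : Fin p) :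
    occ hp v k ∈ Icc (0 : ℝ) 1 := by
  refine ⟨sq_nonneg _, ?_⟩
  have h := PiLp.norm_apply_le v (Fin.castLE hp k)
  rw [hv] at h
  exact pow_le_one₀ (norm_nonneg _) h

/-- A smooth family of real eigenlines carries, up to a constant phase, a unique parallel section:
a real one. -/
theorem exists_phase_of_parallel {w : ℝ → EuclideanSpace ℂ (Fin N)} {S : Set ℝ} (hS : IsOpen S)
    (hS' : IsPreconnected S) (h0 : (0 : ℝ) ∈ S) (hd : DifferentiableOn ℝ w S)
    (hnorm : ∀ t ∈ S, ‖w t‖ = 1) (hpar : ∀ t ∈ S, inner ℂ (w t) (deriv w t) = 0)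
    (hreal : ∀ t ∈ S, ∃ (c : ℂ) (x : EuclideanSpace ℝ (Fin N)), w t = c • ofRealVec x) :
    ∃ c : ℂ, ‖c‖ = 1 ∧ ∀ t ∈ S, c • w t = ofRealVec (reVec (c • w t)) := by
  -- The bilinear square, without conjugation, detects the phase. Since `w t` is a multiple of a
  -- real vector, parallelism also kills `∑ wᵢ wᵢ'`, so `B` is constant.
  let B : ℝ → ℂ := fun t => ∑ i, w t i * w t i
  have hB : ∀ t ∈ S, HasDerivAt B 0 t := by
    intro t ht
    have hw : HasDerivAt w (deriv w t) t := (hd.differentiableAt (hS.mem_nhds ht)).hasDerivAt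
    have hwi : ∀ i, HasDerivAt (fun t => w t i) (deriv w t i) t := fun i =>
      ((EuclideanSpace.proj (𝕜 := ℂ) i).restrictScalars ℝ).hasFDerivAt.comp_hasDerivAt t hw
    have h1 : HasDerivAt B (∑ i, (deriv w t i * w t i + w t i * deriv w t i)) t :=
      HasDerivAt.fun_sum fun i _ => (hwi i).mul (hwi i)
    convert! h1 using 1
    obtain ⟨c, x, hcx⟩ := hreal t ht
    have hc : c ≠ 0 := by
      rintro rfl
      have := hnorm t ht
      rw [hcx, zero_smul, norm_zero] at this
      exact zero_ne_one this
    have h2 := hpar t ht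
    rw [hcx, inner_smul_left] at h2
    have h3 := (mul_eq_zero.1 h2).resolve_left (by simpa using hc)
    have h4 : ∑ i, (x i : ℂ) * deriv w t i = 0 := by
      rw [← h3, PiLp.inner_apply]
      refine Finset.sum_congr rfl fun i _ => ?_
      simp [mul_comm]
    calc (0 : ℂ) = 2 * c * ∑ i, (x i : ℂ) * deriv w t i := by rw [h4, mul_zero]
      _ = _ := by
        rw [Finset.mul_sum]
        refine Finset.sum_congr rfl fun i _ => ?_
        rw [hcx]
        simp
        ring
  have hconst : ∀ t ∈ S, B t = B 0 := fun t ht =>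
    hS.is_const_of_deriv_eq_zero hS' (fun u hu => (hB u hu).differentiableAt.differentiableWithinAt)
      (fun u hu => (hB u hu).deriv) ht h0
  obtain ⟨c, x, hcx⟩ := hreal 0 h0
  have hcx1 : ‖c‖ * ‖x‖ = 1 := by
    rw [← hnorm 0 h0, hcx, norm_smul, norm_ofRealVec]
  have hB0 : B 0 = c ^ 2 * (‖x‖ ^ 2 : ℝ) := by
    simp only [B, hcx, EuclideanSpace.norm_sq_eq]
    push_cast
    rw [Finset.mul_sum]
    refine Finset.sum_congr rfl fun i _ => ?_
    simp only [PiLp.smul_apply, ofRealVec_apply, smul_eq_mul, Real.norm_eq_abs]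
    rw [← Complex.ofReal_pow, sq_abs]
    push_cast; ring
  have hx0 : (‖x‖ : ℂ) ≠ 0 := by
    intro h
    rw [Complex.ofReal_eq_zero.1 h, mul_zero] at hcx1
    exact zero_ne_one hcx1
  have hc0 : c ≠ 0 := by
    rintro rfl
    simp at hcx1
  have hcn : ‖(c * (‖x‖ : ℂ))⁻¹‖ = 1 := by
    rw [norm_inv, norm_mul, Complex.norm_real, norm_norm, hcx1, inv_one]
  refine ⟨(c * (‖x‖ : ℂ))⁻¹, hcn, fun t ht => ?_⟩
  -- After this normalisation `z` has norm 1 and bilinear square 1: the sum and the difference of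
  -- `‖reVec z‖ ^ 2` and `‖imVec z‖ ^ 2` are both 1, so `z` is real.
  set z := (c * (‖x‖ : ℂ))⁻¹ • w t with hz
  have hz1 : ‖z‖ ^ 2 = 1 := by
    rw [hz, norm_smul, hnorm t ht, hcn]; norm_num
  have hz2 : ∑ i, z i * z i = 1 := by
    have h1 : ∑ i, z i * z i = ((c * (‖x‖ : ℂ))⁻¹) ^ 2 * B t := by
      simp only [B, Finset.mul_sum]
      refine Finset.sum_congr rfl fun i _ => ?_
      simp only [hz, PiLp.smul_apply, smul_eq_mul]
      ring
    rw [h1, hconst t ht, hB0]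
    push_cast
    field_simp
  have hz3 : ‖reVec z‖ ^ 2 - ‖imVec z‖ ^ 2 = 1 := by
    have := congrArg Complex.re hz2
    rw [Complex.re_sum, Complex.one_re] at this
    rw [← this, EuclideanSpace.norm_sq_eq, EuclideanSpace.norm_sq_eq, ← Finset.sum_sub_distrib]
    refine Finset.sum_congr rfl fun i _ => ?_
    simp [Complex.mul_re, sq]
  have hz4 : imVec z = 0 := by
    have h1 := norm_sq_eq_reVec_add_imVec z
    have : ‖imVec z‖ ^ 2 = 0 := by linarith
    exact norm_eq_zero.1 (pow_eq_zero_iff two_ne_zero |>.1 this)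
  have h5 := ofRealVec_add_I_smul z
  rw [hz4, map_zero, smul_zero, add_zero] at h5
  exact h5.symm

end RealStructure

end NonlinearAdiabatic

namespace NonlinearAdiabatic

open Filter Topology

/-! ### Norm conservation and linearisation of the flow -/

section Dynamics

variable {N p : ℕ}

/-- Second order Taylor estimate, uniformly near a point. -/
theorem exists_taylor_bound {E G : Type*} [NormedAddCommGroup E] [NormedSpace ℝ E]
    [NormedAddCommGroup G] [NormedSpace ℝ G] {F : E → G} {q₀ : E} (hF : ContDiffAt ℝ 2 F q₀) :
    ∃ C ≥ 0, ∃ ρ > 0, ∀ q ∈ Metric.ball q₀ ρ, ‖fderiv ℝ F q‖ ≤ C ∧ ∀ q' ∈ Metric.ball q₀ ρ,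
      ‖F q' - F q‖ ≤ C * ‖q' - q‖ ∧
      ‖F q' - F q - fderiv ℝ F q (q' - q)‖ ≤ C * ‖q' - q‖ ^ 2 := by
  have hF1 : ContDiffAt ℝ 1 F q₀ := hF.of_le one_le_two
  have hF' : ContDiffAt ℝ 1 (fderiv ℝ F) q₀ := hF.fderiv_right (by norm_num)
  obtain ⟨L, u, hu, hL⟩ := hF'.exists_lipschitzOnWith
  have hd : ∀ᶠ q in 𝓝 q₀, DifferentiableAt ℝ F q :=
    (hF1.eventually (by simp)).mono fun q hq => hq.differentiableAt one_ne_zero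
  have hb : ∀ᶠ q in 𝓝 q₀, ‖fderiv ℝ F q‖ ≤ ‖fderiv ℝ F q₀‖ + 1 :=
    hF'.continuousAt.norm.eventually_le_const (lt_add_one _)
  obtain ⟨ρ, hρ, hball⟩ := Metric.eventually_nhds_iff_ball.1 (hd.and (hb.and hu))
  have hC1 : ‖fderiv ℝ F q₀‖ + 1 ≤ max (‖fderiv ℝ F q₀‖ + 1) L := le_max_left _ _
  have hC2 : (L : ℝ) ≤ max (‖fderiv ℝ F q₀‖ + 1) L := le_max_right _ _
  refine ⟨max (‖fderiv ℝ F q₀‖ + 1) L, L.coe_nonneg.trans hC2, ρ, hρ,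
    fun q hq => ⟨(hball q hq).2.1.trans hC1, fun q' hq' => ⟨?_, ?_⟩⟩⟩
  · exact (convex_ball q₀ ρ).norm_image_sub_le_of_norm_fderiv_le (fun x hx => (hball x hx).1)
      (fun x hx => (hball x hx).2.1.trans hC1) hq hq'
  -- On this smaller convex set the derivative differs from its value at `q` by at most `L * ‖q' -
  -- q‖`, which makes the remainder quadratic.
  · have hconv : Convex ℝ (Metric.ball q₀ ρ ∩ Metric.closedBall q ‖q' - q‖) :=
      (convex_ball q₀ ρ).inter (convex_closedBall _ _)
    have := hconv.norm_image_sub_le_of_norm_fderiv_le' (f := F) (φ := fderiv ℝ F q)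
      (C := L * ‖q' - q‖) (x := q) (y := q') (fun x hx => (hball x hx.1).1)
      (fun x hx => by
        refine (hL.norm_sub_le (hball x hx.1).2.2 (hball q hq).2.2).trans ?_
        gcongr
        exact mem_closedBall_iff_norm.1 hx.2)
      ⟨hq, Metric.mem_closedBall_self (norm_nonneg _)⟩
      ⟨hq', mem_closedBall_iff_norm.2 le_rfl⟩
    refine this.trans ?_
    rw [mul_assoc, ← sq]
    gcongr

theorem contDiff_occ {hp : p ≤ N} {n : ℕ∞ω} :
    ContDiff ℝ n (occ hp : EuclideanSpace ℂ (Fin N) → Fin p → ℝ) := by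
  refine contDiff_pi.2 fun k => ?_
  simp only [occ_apply]
  have h1 : ContDiff ℝ n fun v : EuclideanSpace ℂ (Fin N) => reVec v (Fin.castLE hp k) :=
    ((EuclideanSpace.proj (𝕜 := ℝ) (Fin.castLE hp k)) ∘L reVec).contDiff
  have h2 : ContDiff ℝ n fun v : EuclideanSpace ℂ (Fin N) => imVec v (Fin.castLE hp k) :=
    ((EuclideanSpace.proj (𝕜 := ℝ) (Fin.castLE hp k)) ∘L imVec).contDiff
  exact (h1.pow 2).add (h2.pow 2)

/-- The Schrödinger equation of a real operator as a real system. -/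
theorem hasDerivAt_reVec_imVec {A : Op N} (hA : IsRealOp A) {ε l t : ℝ} (hε : 0 < ε)
    {z : ℝ → EuclideanSpace ℂ (Fin N)} {z' : EuclideanSpace ℂ (Fin N)} (hz : HasDerivAt z z' t)
    (h : (Complex.I * (ε : ℂ)) • z' = A (z t) - l • z t) :
    HasDerivAt (fun s => reVec (z s)) (ε⁻¹ • (reOp A (imVec (z t)) - l • imVec (z t))) t ∧
    HasDerivAt (fun s => imVec (z s)) (-(ε⁻¹ • (reOp A (reVec (z t)) - l • reVec (z t)))) t := by
  have h' : Complex.I • (ε • z') = A (z t) - l • z t := by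
    rw [← h, mul_smul]; rfl
  have h1 : reVec z' = ε⁻¹ • (reOp A (imVec (z t)) - l • imVec (z t)) := by
    rw [eq_inv_smul_iff₀ hε.ne', ← hA.imVec_apply, ← map_smul, ← map_smul imVec, ← map_sub, ← h',
      imVec_I_smul]
  have h2 : imVec z' = -(ε⁻¹ • (reOp A (reVec (z t)) - l • reVec (z t))) := by
    rw [← smul_neg, eq_inv_smul_iff₀ hε.ne', ← hA.reVec_apply, ← map_smul, ← map_smul reVec,
      ← map_sub, ← h', reVec_I_smul, neg_neg]
  rw [← h1, ← h2]
  exact ⟨reVec.hasFDerivAt.comp_hasDerivAt t hz, imVec.hasFDerivAt.comp_hasDerivAt t hz⟩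

/-- Conservation of the norm. -/
theorem IsSolution.norm_eq_one {hp : p ≤ N} {H : ℝ × (Fin p → ℝ) → Op N} {T X S : Set ℝ}
    (hH : SmoothSelfAdjoint T X H) (hreal : ∀ q ∈ paramDomain p T X, IsRealOp (H q)) {ε : ℝ}
    (hε : 0 < ε) {v : ℝ → EuclideanSpace ℂ (Fin N)} (hS : IsOpen S) (hS' : IsPreconnected S)
    (hST : S ⊆ T) (h0 : (0 : ℝ) ∈ S) (hv : IsSolution hp H ε S v) (hv0 : ‖v 0‖ = 1) :
    ∀ t ∈ S, ‖v t‖ = 1 := by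
  have hcont : ContinuousOn v S := fun t ht => (hv t ht).1.continuousAt.continuousWithinAt
  suffices h : S ⊆ {t | t ∈ S ∧ ‖v t‖ = 1} from fun t ht => (h ht).2
  -- `H` is controlled only on the parameter domain, so conservation cannot be integrated directly.
  -- Where `‖v‖ = 1`, the occupations lie in `[0, 1]^p` and hence nearby in the open set `X^p`,
  -- where the norm is constant; connectedness concludes.
  refine hS'.subset_of_closure_inter_subset ?_ ⟨0, h0, h0, hv0⟩ ?_
  · rw [isOpen_iff_mem_nhds]
    rintro t₀ ⟨ht₀, hvt₀⟩
    have hX : IsOpen (Set.univ.pi fun _ : Fin p => X) :=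
      isOpen_set_pi finite_univ fun _ _ => hH.isOpen_X
    have hocc : ∀ᶠ t in 𝓝 t₀, occ hp (v t) ∈ Set.univ.pi fun _ : Fin p => X := by
      have hc : ContinuousAt (fun t => occ hp (v t)) t₀ :=
        (contDiff_occ (n := 0)).continuous.continuousAt.comp (hv t₀ ht₀).1.continuousAt
      exact hc.eventually_mem (hX.mem_nhds fun k _ => hH.subset_X (occ_mem_Icc hvt₀ k))
    obtain ⟨σ, hσ, hball⟩ := Metric.eventually_nhds_iff_ball.1 (hocc.and (hS.mem_nhds ht₀))
    refine mem_of_superset (Metric.ball_mem_nhds t₀ hσ) fun t ht => ⟨(hball t ht).2, ?_⟩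
    have hder : ∀ s ∈ Metric.ball t₀ σ, HasDerivAt
        (fun s => ‖reVec (v s)‖ ^ 2 + ‖imVec (v s)‖ ^ 2) 0 s := by
      intro s hs
      have hq : (s, occ hp (v s)) ∈ paramDomain p T X := ⟨hST (hball s hs).2, (hball s hs).1⟩
      obtain ⟨d1, d2⟩ := hv s (hball s hs).2
      obtain ⟨e1, e2⟩ := hasDerivAt_reVec_imVec (hreal _ hq) (l := 0) hε d1.hasDerivAt
        (by rw [d2, zero_smul, sub_zero])
      convert! e1.norm_sq.add e2.norm_sq using 1
      simp only [zero_smul, sub_zero, inner_smul_right, inner_neg_right]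
      rw [← reOp_symm (hH.selfAdjoint _ hq) (hreal _ hq), real_inner_comm]
      ring
    have hc := Metric.isOpen_ball.is_const_of_deriv_eq_zero (convex_ball t₀ σ).isPreconnected
      (fun s hs => (hder s hs).differentiableAt.differentiableWithinAt)
      (fun s hs => (hder s hs).deriv) ht (Metric.mem_ball_self hσ)
    simp only [← norm_sq_eq_reVec_add_imVec, hvt₀] at hc
    exact (pow_left_inj₀ (norm_nonneg _) zero_le_one two_ne_zero).1 hc
  · rintro t ⟨ht, htS⟩
    refine ⟨htS, ?_⟩
    have hc : ContinuousAt (fun t => ‖v t‖) t := (hv t htS).1.continuousAt.norm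
    have h2 : ∃ᶠ s in 𝓝 t, ‖v s‖ = 1 := (mem_closure_iff_frequently.1 ht).mono fun s hs => hs.2
    by_contra hne
    exact h2 ((hc.eventually_ne hne).mono fun s hs => hs)

/-- The derivative of `a ↦ F (t, [r + a]) r` at `a = 0`. -/
noncomputable def occDeriv (hp : p ≤ N)
    (D : (ℝ × (Fin p → ℝ)) →L[ℝ]
      (EuclideanSpace ℝ (Fin N) →L[ℝ] EuclideanSpace ℝ (Fin N)))
    (r : EuclideanSpace ℝ (Fin N)) : EuclideanSpace ℝ (Fin N) →L[ℝ] EuclideanSpace ℝ (Fin N) :=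
  ∑ k : Fin p, (EuclideanSpace.proj (𝕜 := ℝ) (Fin.castLE hp k)).smulRight
    ((2 * r (Fin.castLE hp k)) • D (0, Pi.single k 1) r)

theorem occDeriv_apply (hp : p ≤ N)
    (D : (ℝ × (Fin p → ℝ)) →L[ℝ]
      (EuclideanSpace ℝ (Fin N) →L[ℝ] EuclideanSpace ℝ (Fin N)))
    (r a : EuclideanSpace ℝ (Fin N)) :
    occDeriv hp D r a
      = D (0, fun k => 2 * r (Fin.castLE hp k) * a (Fin.castLE hp k)) r := by
  have h1 : ((0 : ℝ), fun k => 2 * r (Fin.castLE hp k) * a (Fin.castLE hp k))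
      = ∑ k : Fin p, (2 * r (Fin.castLE hp k) * a (Fin.castLE hp k)) •
        ((0 : ℝ), (Pi.single k 1 : Fin p → ℝ)) := by
    ext k
    · simp [Prod.fst_sum]
    · simp [Prod.snd_sum, Finset.sum_apply, Pi.single_apply]
  rw [h1, map_sum, sum_apply, occDeriv, sum_apply]
  refine Finset.sum_congr rfl fun k _ => ?_
  rw [map_smul, smul_apply, ContinuousLinearMap.smulRight_apply, smul_smul, mul_comm]
  rfl

/-- There are `p` terms, each with a factor 2 from differentiating a square and coordinates bounded
by norms. This is how small `δ` makes `M` close to `K`. -/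
theorem norm_occDeriv_apply_le (hp : p ≤ N)
    {D : (ℝ × (Fin p → ℝ)) →L[ℝ]
      (EuclideanSpace ℝ (Fin N) →L[ℝ] EuclideanSpace ℝ (Fin N))}
    {r : EuclideanSpace ℝ (Fin N)} {δ : ℝ} (hr : ‖r‖ = 1)
    (hD : ∀ k : Fin p, ‖D (0, Pi.single k 1) r‖ ≤ δ) (a : EuclideanSpace ℝ (Fin N)) :
    ‖occDeriv hp D r a‖ ≤ 2 * p * δ * ‖a‖ := by
  rw [occDeriv, sum_apply]
  refine (norm_sum_le _ _).trans ?_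
  have : ∀ k ∈ (Finset.univ : Finset (Fin p)),
      ‖((EuclideanSpace.proj (𝕜 := ℝ) (Fin.castLE hp k)).smulRight
        ((2 * r (Fin.castLE hp k)) • D (0, Pi.single k 1) r)) a‖ ≤ 2 * δ * ‖a‖ := by
    intro k _
    have h1 := PiLp.norm_apply_le r (Fin.castLE hp k)
    have h2 := PiLp.norm_apply_le a (Fin.castLE hp k)
    rw [hr] at h1
    simp only [ContinuousLinearMap.smulRight_apply, norm_smul, norm_mul, Real.norm_ofNat]
    have hδ := hD k
    calc _ ≤ ‖a‖ * (2 * 1 * δ) := by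
          gcongr
          exact h2
      _ = _ := by ring
  refine (Finset.sum_le_sum this).trans (le_of_eq ?_)
  simp
  ring

theorem contDiffAt_occDeriv (hp : p ≤ N)
    {D : ℝ → (ℝ × (Fin p → ℝ)) →L[ℝ]
      (EuclideanSpace ℝ (Fin N) →L[ℝ] EuclideanSpace ℝ (Fin N))}
    {r : ℝ → EuclideanSpace ℝ (Fin N)} (hD : ContDiffAt ℝ 1 D 0) (hr : ContDiffAt ℝ 1 r 0) :
    ContDiffAt ℝ 1 (fun t => occDeriv hp (D t) (r t)) 0 := by
  refine ContDiffAt.sum fun k _ => contDiffAt_const.smulRight ?_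
  have h1 : ContDiffAt ℝ 1 (fun t => r t (Fin.castLE hp k)) 0 :=
    (EuclideanSpace.proj (𝕜 := ℝ) (Fin.castLE hp k)).contDiff.contDiffAt.comp 0 hr
  exact (contDiffAt_const.mul h1).smul ((hD.clm_apply contDiffAt_const).clm_apply hr)

/-- The nonlinear terms of the real system are quadratic in the deviation `(a, b)`. -/
theorem quadratic_remainder (hp : p ≤ N)
    {F : ℝ × (Fin p → ℝ) → EuclideanSpace ℝ (Fin N) →L[ℝ] EuclideanSpace ℝ (Fin N)}
    {C ρ : ℝ} (hC : 0 ≤ C) {q₀ : ℝ × (Fin p → ℝ)}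
    (hF : ∀ q ∈ Metric.ball q₀ ρ, ‖fderiv ℝ F q‖ ≤ C ∧ ∀ q' ∈ Metric.ball q₀ ρ,
      ‖F q' - F q‖ ≤ C * ‖q' - q‖ ∧
      ‖F q' - F q - fderiv ℝ F q (q' - q)‖ ≤ C * ‖q' - q‖ ^ 2)
    {t : ℝ} {u : EuclideanSpace ℂ (Fin N)} {r a b : EuclideanSpace ℝ (Fin N)} (hr : ‖r‖ = 1)
    (ha : ‖a‖ ≤ 1) (hb : ‖b‖ ≤ 1) (ha' : ‖a‖ ≤ ρ / 13) (hb' : ‖b‖ ≤ ρ / 13)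
    (hre : reVec u = r + a) (him : imVec u = b) {x : Fin p → ℝ}
    (hx : x = occ hp (ofRealVec r)) (hq : (t, x) ∈ Metric.ball q₀ (ρ / 2)) :
    (∀ c, ‖F (t, occ hp u) c - F (t, x) c‖ ≤ 3 * C * (‖a‖ + ‖b‖) * ‖c‖) ∧
    ‖F (t, occ hp u) r - F (t, x) r - occDeriv hp (fderiv ℝ F (t, x)) r a‖
      ≤ 19 * C * (‖a‖ ^ 2 + ‖b‖ ^ 2) := by
  have hcoord : ∀ (y : EuclideanSpace ℝ (Fin N)) k, |y k| ≤ ‖y‖ := fun y k =>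
    PiLp.norm_apply_le y k
  set η : Fin p → ℝ := occ hp u - x with hη
  have hηk : ∀ k, η k = 2 * r (Fin.castLE hp k) * a (Fin.castLE hp k)
      + (a (Fin.castLE hp k) ^ 2 + b (Fin.castLE hp k) ^ 2) := by
    intro k
    rw [hη, Pi.sub_apply, hx, occ_apply, occ_apply, hre, him]
    simp
    ring
  have hsq : ∀ k, |a (Fin.castLE hp k) ^ 2 + b (Fin.castLE hp k) ^ 2| ≤ ‖a‖ ^ 2 + ‖b‖ ^ 2 := by
    intro k
    have h1 := hcoord a (Fin.castLE hp k)
    have h2 := hcoord b (Fin.castLE hp k)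
    rw [abs_of_nonneg (by positivity), ← sq_abs, ← sq_abs (b _)]
    gcongr
  -- Uses `‖a‖, ‖b‖ ≤ 1`. With `‖a‖, ‖b‖ ≤ ρ / 13` the displacement is at most `6 * ρ / 13 < ρ / 2`,
  -- so the displaced point stays in the Taylor ball.
  have hηn : ‖η‖ ≤ 3 * (‖a‖ + ‖b‖) := by
    refine (pi_norm_le_iff_of_nonneg (by positivity)).2 fun k => ?_
    rw [hηk, Real.norm_eq_abs]
    refine (abs_add_le _ _).trans ?_
    have h1 : |2 * r (Fin.castLE hp k) * a (Fin.castLE hp k)| ≤ 2 * 1 * ‖a‖ := by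
      rw [abs_mul, abs_mul, abs_two]
      gcongr
      · rw [← hr]; exact hcoord _ _
      · exact hcoord _ _
    have h2 := hsq k
    have h3 : ‖a‖ ^ 2 ≤ ‖a‖ := by nlinarith [norm_nonneg a]
    have h4 : ‖b‖ ^ 2 ≤ ‖b‖ := by nlinarith [norm_nonneg b]
    linarith [norm_nonneg b]
  have hdiff : ((t, occ hp u) : ℝ × (Fin p → ℝ)) - (t, x) = (0, η) := by
    simp [hη]
  have hnη : ‖((0 : ℝ), η)‖ = ‖η‖ := by simp [Prod.norm_def]
  have hρ : 0 < ρ / 2 := Metric.pos_of_mem_ball hq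
  have hqb : (t, x) ∈ Metric.ball q₀ ρ := Metric.ball_subset_ball (by linarith) hq
  have hqb' : (t, occ hp u) ∈ Metric.ball q₀ ρ := by
    rw [mem_ball_iff_norm] at hq ⊢
    have h1 : ((t, occ hp u) : ℝ × (Fin p → ℝ)) - q₀ = (0, η) + ((t, x) - q₀) := by
      rw [← hdiff]; abel
    rw [h1]
    refine (norm_add_le _ _).trans_lt ?_
    rw [hnη]
    linarith
  obtain ⟨h1, h2⟩ := hF _ hqb
  obtain ⟨h3, h4⟩ := h2 _ hqb'
  rw [hdiff, hnη] at h3 h4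
  refine ⟨fun c => ?_, ?_⟩
  · rw [← sub_apply]
    refine (ContinuousLinearMap.le_opNorm _ _).trans ?_
    gcongr
    refine h3.trans ?_
    calc C * ‖η‖ ≤ C * (3 * (‖a‖ + ‖b‖)) := by gcongr
      _ = _ := by ring
  · set ℓ : Fin p → ℝ := fun k => 2 * r (Fin.castLE hp k) * a (Fin.castLE hp k) with hℓ
    have h5 : ‖((0 : ℝ), η - ℓ)‖ ≤ ‖a‖ ^ 2 + ‖b‖ ^ 2 := by
      have : ‖((0 : ℝ), η - ℓ)‖ = ‖η - ℓ‖ := by simp [Prod.norm_def]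
      rw [this]
      refine (pi_norm_le_iff_of_nonneg (by positivity)).2 fun k => ?_
      rw [Pi.sub_apply, hηk, Real.norm_eq_abs]
      simpa [hℓ] using hsq k
    -- The first term is the Taylor remainder, the second the quadratic part of the occupations;
    -- they contribute 18 and 1 to the constant 19.
    have h6 : F (t, occ hp u) r - F (t, x) r - occDeriv hp (fderiv ℝ F (t, x)) r a
        = (F (t, occ hp u) - F (t, x) - fderiv ℝ F (t, x) (0, η)) r
          + fderiv ℝ F (t, x) (0, η - ℓ) r := by
      rw [occDeriv_apply, ← hℓ]
      have : ((0 : ℝ), η - ℓ) = (0, η) - (0, ℓ) := by simp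
      rw [this, map_sub]
      simp only [sub_apply]
      abel
    rw [h6]
    refine (norm_add_le _ _).trans ?_
    have h7 : ‖η‖ ^ 2 ≤ 18 * (‖a‖ ^ 2 + ‖b‖ ^ 2) := by
      calc ‖η‖ ^ 2 ≤ (3 * (‖a‖ + ‖b‖)) ^ 2 := by gcongr
        _ ≤ _ := by nlinarith [sq_nonneg (‖a‖ - ‖b‖)]
    have h8 : ‖(F (t, occ hp u) - F (t, x) - fderiv ℝ F (t, x) (0, η)) r‖
        ≤ C * (18 * (‖a‖ ^ 2 + ‖b‖ ^ 2)) := by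
      refine (ContinuousLinearMap.le_opNorm _ _).trans ?_
      rw [hr, mul_one]
      exact h4.trans (by gcongr)
    have h9 : ‖fderiv ℝ F (t, x) (0, η - ℓ) r‖ ≤ C * (‖a‖ ^ 2 + ‖b‖ ^ 2) := by
      refine (ContinuousLinearMap.le_opNorm _ _).trans ?_
      rw [hr, mul_one]
      exact (ContinuousLinearMap.le_opNorm _ _).trans (by gcongr)
    linarith

end Dynamics

end NonlinearAdiabatic

namespace NonlinearAdiabatic

open Filter Topology

/-! ### Consequences of the spectral hypotheses on `H` -/

section Structure

variable {N p : ℕ} {T X : Set ℝ} {H : ℝ × (Fin p → ℝ) → Op N}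
  {lam : Fin N → ℝ × (Fin p → ℝ) → ℝ} {g : ℝ}

theorem SmoothSelfAdjoint.isOpen_paramDomain (hH : SmoothSelfAdjoint T X H) :
    IsOpen (paramDomain p T X) :=
  hH.isOpen_T.prod (isOpen_set_pi finite_univ fun _ _ => hH.isOpen_X)

theorem SmoothSelfAdjoint.occ_mem {hp : p ≤ N} (hH : SmoothSelfAdjoint T X H) {t : ℝ}
    (ht : t ∈ T) {v : EuclideanSpace ℂ (Fin N)} (hv : ‖v‖ = 1) :
    (t, occ hp v) ∈ paramDomain p T X :=
  ⟨ht, fun k _ => hH.subset_X (occ_mem_Icc hv k)⟩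

theorem SimpleGappedSpectrum.le_abs_sub (hspec : SimpleGappedSpectrum T X H lam g)
    {q : ℝ × (Fin p → ℝ)} (hq : q ∈ paramDomain p T X) {i j : Fin N} (hij : i ≠ j) :
    g ≤ |lam i q - lam j q| := by
  rcases lt_or_gt_of_ne hij with h | h
  · have := hspec.gap q hq i j h
    exact le_abs.2 (Or.inr (by linarith))
  · have := hspec.gap q hq j i h
    exact le_abs.2 (Or.inl (by linarith))

theorem SimpleGappedSpectrum.exists_eigenbasis (hg : 0 < g) (hH : SmoothSelfAdjoint T X H)
    (hspec : SimpleGappedSpectrum T X H lam g) (hreal : ∀ q ∈ paramDomain p T X, IsRealOp (H q))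
    (j₀ : Fin N) {q : ℝ × (Fin p → ℝ)} (hq : q ∈ paramDomain p T X) :
    ∃ e : OrthonormalBasis (Fin N) ℝ (EuclideanSpace ℝ (Fin N)),
      ∀ j, (reOp (H q) - lam j₀ q • ContinuousLinearMap.id ℝ (EuclideanSpace ℝ (Fin N))) (e j)
        = (lam j q - lam j₀ q) • e j := by
  have hinj : Function.Injective fun j => lam j q := by
    intro i j hij
    by_contra hne
    have := hspec.le_abs_sub hq hne
    rw [show lam i q = lam j q from hij, sub_self, abs_zero] at this
    linarith
  obtain ⟨e, he⟩ := exists_real_eigenbasis (hH.selfAdjoint q hq) (hreal q hq) hinj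
    (hspec.spectrum_eq q hq)
  exact ⟨e, fun j => by simp [he, sub_smul]⟩

theorem SimpleGappedSpectrum.gappedAt (hg : 0 < g) (hH : SmoothSelfAdjoint T X H)
    (hspec : SimpleGappedSpectrum T X H lam g) (hreal : ∀ q ∈ paramDomain p T X, IsRealOp (H q))
    (j₀ : Fin N) {q : ℝ × (Fin p → ℝ)} (hq : q ∈ paramDomain p T X)
    {r : EuclideanSpace ℝ (Fin N)} (hr : ‖r‖ = 1) (hHr : reOp (H q) r = lam j₀ q • r) :
    GappedAt (reOp (H q) - lam j₀ q • ContinuousLinearMap.id ℝ (EuclideanSpace ℝ (Fin N))) r g := by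
  obtain ⟨e, he⟩ := hspec.exists_eigenbasis hg hH hreal j₀ hq
  refine gappedAt_of_eigenbasis e he hg (fun j hj => hspec.le_abs_sub hq hj) (fun x y => ?_) hr ?_
  · simp [inner_sub_left, inner_sub_right, reOp_symm (hH.selfAdjoint q hq) (hreal q hq),
      inner_smul_left, inner_smul_right]
  · simp [hHr]

/-- The eigenvectors of a real operator for a simple eigenvalue are real up to a phase. -/
theorem SimpleGappedSpectrum.exists_eq_smul_ofRealVec (hg : 0 < g) (hH : SmoothSelfAdjoint T X H)
    (hspec : SimpleGappedSpectrum T X H lam g) (hreal : ∀ q ∈ paramDomain p T X, IsRealOp (H q))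
    (j₀ : Fin N) {q : ℝ × (Fin p → ℝ)} (hq : q ∈ paramDomain p T X)
    {z : EuclideanSpace ℂ (Fin N)} (hz : H q z = ((lam j₀ q : ℝ) : ℂ) • z) :
    ∃ (c : ℂ) (x : EuclideanSpace ℝ (Fin N)), z = c • ofRealVec x := by
  obtain ⟨e, he⟩ := hspec.exists_eigenbasis hg hH hreal j₀ hq
  have hgap := hspec.gappedAt hg hH hreal j₀ hq (e.orthonormal.1 j₀) (by
    have := he j₀
    rwa [sub_self, zero_smul, sub_apply, sub_eq_zero] at this)
  have hz' : H q z = lam j₀ q • z := hz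
  have hre : reOp (H q) (reVec z) = lam j₀ q • reVec z := by
    rw [← (hreal q hq).reVec_apply, hz', map_smul]
  have him : reOp (H q) (imVec z) = lam j₀ q • imVec z := by
    rw [← (hreal q hq).imVec_apply, hz', map_smul]
  have h1 := hgap.eq_smul_of_apply_eq_zero hg (x := reVec z) (by simp [hre])
  have h2 := hgap.eq_smul_of_apply_eq_zero hg (x := imVec z) (by simp [him])
  refine ⟨(inner ℝ (e j₀) (reVec z) : ℝ) + Complex.I * (inner ℝ (e j₀) (imVec z) : ℝ), e j₀, ?_⟩
  conv_lhs => rw [← ofRealVec_add_I_smul z, h1, h2]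
  rw [map_smul, map_smul, add_smul, mul_smul]
  rfl

theorem SmoothSelfAdjoint.contDiffAt_reOp (hH : SmoothSelfAdjoint T X H) {q : ℝ × (Fin p → ℝ)}
    (hq : q ∈ paramDomain p T X) : ContDiffAt ℝ ∞ (fun q => reOp (H q)) q :=
  reOp.contDiff.contDiffAt.comp q (hH.smooth.contDiffAt (hH.isOpen_paramDomain.mem_nhds hq))

theorem PartialsBounded.norm_fderiv_reOp_le {δ : ℝ} (hpart : PartialsBounded T X H δ)
    (hH : SmoothSelfAdjoint T X H) {t : ℝ} {x : Fin p → ℝ} (hq : (t, x) ∈ paramDomain p T X)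
    {r : EuclideanSpace ℝ (Fin N)} (hr : ‖r‖ = 1) (k : Fin p) :
    ‖fderiv ℝ (fun q => reOp (H q)) (t, x) (0, Pi.single k 1) r‖ ≤ δ := by
  have hd : DifferentiableAt ℝ H (t, x) :=
    (hH.smooth.contDiffAt (hH.isOpen_paramDomain.mem_nhds hq)).differentiableAt (by simp)
  have h1 : fderiv ℝ (fun q => reOp (H q)) (t, x) (0, Pi.single k 1)
      = reOp (fderiv ℝ (fun y : Fin p → ℝ => H (t, y)) x (Pi.single k 1)) := by
    have e1 := (reOp.hasFDerivAt.comp (t, x) hd.hasFDerivAt).fderiv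
    have e2 := (hd.hasFDerivAt.comp x (hasFDerivAt_prodMk_right t x)).fderiv
    rw [show (fun y : Fin p → ℝ => H (t, y)) = H ∘ fun y => (t, y) from rfl, e2,
      show (fun q => reOp (H q)) = reOp ∘ H from rfl, e1]
    rfl
  rw [h1]
  refine (norm_reOp_apply_le _ _).trans ?_
  rw [hr, mul_one]
  exact hpart t x hq k

end Structure

/-- The product of a solution with a dynamical phase. -/
theorem hasDerivAt_phase_smul {N : ℕ} {v : ℝ → EuclideanSpace ℂ (Fin N)}
    {v' y : EuclideanSpace ℂ (Fin N)} {Λ : ℝ → ℝ} {ε l t : ℝ} (c : ℂ) (hε : 0 < ε)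
    (hv : HasDerivAt v v' t) (hv' : (Complex.I * (ε : ℂ)) • v' = y) (hΛ : HasDerivAt Λ l t) :
    ∃ u', HasDerivAt (fun s => (c * Complex.exp (Complex.I / (ε : ℂ) * (Λ s : ℂ))) • v s) u' t ∧
      (Complex.I * (ε : ℂ)) • u'
        = (c * Complex.exp (Complex.I / (ε : ℂ) * (Λ t : ℂ))) • y
          - l • (c * Complex.exp (Complex.I / (ε : ℂ) * (Λ t : ℂ))) • v t := by
  have h1 : HasDerivAt (fun s => c * Complex.exp (Complex.I / (ε : ℂ) * (Λ s : ℂ)))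
      (c * (Complex.exp (Complex.I / (ε : ℂ) * (Λ t : ℂ)) * (Complex.I / (ε : ℂ) * (l : ℂ)))) t :=
    ((hΛ.ofReal_comp.const_mul _).cexp).const_mul c
  refine ⟨_, h1.smul hv, ?_⟩
  rw [smul_add, smul_comm (Complex.I * (ε : ℂ)) _ v', hv', smul_smul, sub_eq_add_neg]
  congr 1
  have hε' : (ε : ℂ) ≠ 0 := by exact_mod_cast hε.ne'
  rw [← neg_smul, ← Complex.coe_smul, smul_smul]
  congr 1
  push_cast
  field_simp
  rw [Complex.I_sq]
  ring

end NonlinearAdiabatic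

/-! ### Assembly of the adiabatic theorem -/

namespace NonlinearAdiabatic

open Filter Topology

theorem add_mul_self_le (x y : ℝ) : (x + y) * x ≤ 2 * (x ^ 2 + y ^ 2) := by
  nlinarith [sq_nonneg (x - y), sq_nonneg x, sq_nonneg y]

set_option maxHeartbeats 1000000 in
/-- The adiabatic estimate, when the partial derivatives are small compared with the spectral
gap and with the genericity margin. -/
theorem exists_adiabatic_bound {N p : ℕ} (hp : p ≤ N) {g d δ : ℝ} (hg : 0 < g) (hd : 0 < d)
    (hδ : 8 * (p + 1) * δ ≤ min g d) (hδ0 : 0 < δ) {T X : Set ℝ} {H : ℝ × (Fin p → ℝ) → Op N}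
    {lam : Fin N → ℝ × (Fin p → ℝ) → ℝ} {j₀ : Fin N} (hH : SmoothSelfAdjoint T X H)
    (hpart : PartialsBounded T X H δ) (hspec : SimpleGappedSpectrum T X H lam g)
    (hreal : ∀ q ∈ paramDomain p T X, IsRealOp (H q)) (hmargin : GenericMargin lam j₀ d)
    {T₁ : Set ℝ} {w : ℝ → EuclideanSpace ℂ (Fin N)} (hT₁ : IsOpen T₁) (h0 : (0 : ℝ) ∈ T₁)
    (hT₁T : T₁ ⊆ T) (hw : IsNonlinearEigenvector hp H (lam j₀) T₁ w) :
    ∃ τ > 0, ∃ B : ℝ, (∀ t, |t| < τ → t ∈ T₁) ∧ ∀ t, |t| < τ → ∀ ε : ℝ, 0 < ε →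
      ∀ v : ℝ → EuclideanSpace ℂ (Fin N), IsSolution hp H ε (Ioo (-τ) τ) v → v 0 = w 0 →
        ‖v t - Complex.exp (-(Complex.I / (ε : ℂ)) *
          ((∫ s in (0 : ℝ)..t, lam j₀ (s, occ hp (w s)) : ℝ) : ℂ)) • w t‖ ≤ B * ε := by
  obtain ⟨τ₁, hτ₁, hball⟩ := Metric.isOpen_iff.1 hT₁ 0 h0
  -- Connectedness is needed for a single constant phase to make `w` real throughout.
  set S : Set ℝ := Ioo (-τ₁) τ₁ with hSdef
  have hST₁ : S ⊆ T₁ := fun t ht => hball (by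
    rw [mem_ball_zero_iff, Real.norm_eq_abs, abs_lt]; exact ht)
  have hSo : IsOpen S := isOpen_Ioo
  have h0S : (0 : ℝ) ∈ S := ⟨by linarith, hτ₁⟩
  have h2 : (2 : ℕ∞ω) ≤ ∞ := WithTop.coe_le_coe.2 (le_top : (2 : ℕ∞) ≤ ⊤)
  have hmem : ∀ t ∈ T₁, (t, occ hp (w t)) ∈ paramDomain p T X := fun t ht =>
    hH.occ_mem (hT₁T ht) (hw.norm_eq t ht)
  have hwC : ∀ t ∈ S, ContDiffAt ℝ ∞ w t := fun t ht =>
    hw.smooth.contDiffAt (hT₁.mem_nhds (hST₁ ht))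
  -- the gauge in which the instantaneous eigenvector is real
  obtain ⟨c, hc, hcw⟩ := exists_phase_of_parallel hSo (convex_Ioo _ _).isPreconnected h0S
    (fun t ht => ((hwC t ht).differentiableAt (by simp)).differentiableWithinAt)
    (fun t ht => hw.norm_eq t (hST₁ ht)) (fun t ht => hw.parallel t (hST₁ ht))
    (fun t ht => hspec.exists_eq_smul_ofRealVec hg hH hreal j₀ (hmem t (hST₁ ht))
      (hw.eigen t (hST₁ ht)))
  set r : ℝ → EuclideanSpace ℝ (Fin N) := fun t => reVec (c • w t) with hr
  set q : ℝ → ℝ × (Fin p → ℝ) := fun t => (t, occ hp (w t)) with hq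
  set F : ℝ × (Fin p → ℝ) → EuclideanSpace ℝ (Fin N) →L[ℝ] EuclideanSpace ℝ (Fin N) :=
    fun q => reOp (H q) with hF
  have hocc : ∀ t ∈ S, occ hp (w t) = occ hp (ofRealVec (r t)) := fun t ht => by
    rw [hr, ← hcw t ht, occ_smul_of_norm_eq_one hc]
  have hrn : ∀ t ∈ S, ‖r t‖ = 1 := fun t ht => by
    rw [← norm_ofRealVec, hr, ← hcw t ht, norm_smul, hc, hw.norm_eq t (hST₁ ht), mul_one]
  have hFr : ∀ t ∈ S, F (q t) (r t) = lam j₀ (q t) • r t := fun t ht => by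
    have h1 : H (q t) (c • w t) = lam j₀ (q t) • (c • w t) := by
      rw [map_smul, hw.eigen t (hST₁ ht), smul_comm]; rfl
    rw [hF, hr, ← (hreal _ (hmem t (hST₁ ht))).reVec_apply, h1, map_smul]
  have hrC : ∀ t ∈ S, ContDiffAt ℝ ∞ r t := fun t ht =>
    reVec.contDiff.contDiffAt.comp t ((hwC t ht).const_smul c)
  have hqC : ∀ t ∈ S, ContDiffAt ℝ ∞ q t := fun t ht =>
    contDiffAt_id.prodMk (contDiff_occ.contDiffAt.comp t (hwC t ht))
  have hFC : ∀ t ∈ S, ContDiffAt ℝ ∞ F (q t) := fun t ht =>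
    hH.contDiffAt_reOp (hmem t (hST₁ ht))
  have hFqC : ∀ t ∈ S, ContDiffAt ℝ ∞ (fun t => F (q t)) t := fun t ht =>
    (hFC t ht).comp t (hqC t ht)
  -- No regularity of `lam` is assumed; along the eigenvector it equals this smooth Rayleigh
  -- quotient.
  set ν : ℝ → ℝ := fun t => inner ℝ (r t) (F (q t) (r t)) with hν
  have hνC : ∀ t ∈ S, ContDiffAt ℝ ∞ ν t := fun t ht =>
    (hrC t ht).inner ℝ ((hFqC t ht).clm_apply (hrC t ht))
  have hνl : ∀ t ∈ S, ν t = lam j₀ (q t) := fun t ht => by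
    rw [hν]
    simp only
    rw [hFr t ht, inner_smul_right, real_inner_self_eq_norm_sq, hrn t ht]
    ring
  set K : ℝ → EuclideanSpace ℝ (Fin N) →L[ℝ] EuclideanSpace ℝ (Fin N) :=
    fun t => F (q t) - ν t • ContinuousLinearMap.id ℝ _ with hK
  set B : ℝ → EuclideanSpace ℝ (Fin N) →L[ℝ] EuclideanSpace ℝ (Fin N) :=
    fun t => occDeriv hp (fderiv ℝ F (q t)) (r t) with hB
  have hKC : ContDiffAt ℝ 1 K 0 :=
    ((hFqC 0 h0S).sub ((hνC 0 h0S).smul contDiffAt_const)).of_le (by simp)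
  have hBC : ContDiffAt ℝ 1 B 0 := by
    refine contDiffAt_occDeriv hp ?_ ((hrC 0 h0S).of_le (by simp))
    have h1 : ContDiffAt ℝ 1 (fderiv ℝ F) (q 0) := ((hFC 0 h0S).of_le h2).fderiv_right (by norm_num)
    exact h1.comp (0 : ℝ) ((hqC 0 h0S).of_le (by simp))
  have hm : 0 < min g d := lt_min hg hd
  -- This gives both smallness conditions: below half the separation of the `|κ j|`, and `‖M x - K
  -- x‖ ≤ g / 4 * ‖x‖`.
  have hpδ : 2 * p * δ ≤ min g d / 4 := by nlinarith
  have hBn : ∀ t ∈ S, ∀ x, ‖B t x‖ ≤ 2 * p * δ * ‖x‖ := fun t ht x =>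
    norm_occDeriv_apply_le hp (hrn t ht)
      (fun k => hpart.norm_fderiv_reOp_le hH (hmem t (hST₁ ht)) (hrn t ht) k) x
  have hgapped : ∀ t ∈ S, GappedAt (K t) (r t) g := fun t ht => by
    have := hspec.gappedAt hg hH hreal j₀ (hmem t (hST₁ ht)) (hrn t ht) (hFr t ht)
    rw [hK]
    simp only
    rw [hνl t ht]
    exact this
  have hSn : S ∈ 𝓝 (0 : ℝ) := hSo.mem_nhds h0S
  obtain ⟨e, he⟩ := hspec.exists_eigenbasis hg hH hreal j₀ (hmem 0 h0)
  -- The sum of two shifted eigenvalues is controlled by the margin at time 0, or by the gap when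
  -- one of them is the zero eigenvalue.
  have hneq : ∀ i j, i ≠ j → min g d
      ≤ |(lam i (q 0) - lam j₀ (q 0)) + (lam j (q 0) - lam j₀ (q 0))| := by
    intro i j hij
    have hle := fun k (hk : k ≠ j₀) => (min_le_left g d).trans (hspec.le_abs_sub (hmem 0 h0) hk)
    by_cases hi : i = j₀
    · subst hi
      rw [sub_self, zero_add]
      exact hle j hij.symm
    · by_cases hj : j = j₀
      · subst hj
        rw [sub_self, add_zero]
        exact hle i hi
      · refine (min_le_right g d).trans
          ((hmargin _ (occ_mem_Icc (hp := hp) (hw.norm_eq 0 h0)) i j hi hj).trans (le_of_eq ?_))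
        congr 1
        ring
  obtain ⟨μ₀, hμ₀, -, hμpos, hchar⟩ := exists_charpoly_comp_eq_nodal e (B := B 0) he
    (j₀ := j₀) (sub_self _) hm (η := 2 * p * δ) (by linarith) (hBn 0 h0S)
    (fun i j hij => by
      rw [sub_sub_sub_cancel_right]
      exact (min_le_left g d).trans (hspec.le_abs_sub (hmem 0 h0) hij)) hneq
  have hK0 : reOp (H (0, occ hp (w 0))) - lam j₀ (0, occ hp (w 0)) •
      ContinuousLinearMap.id ℝ (EuclideanSpace ℝ (Fin N)) = K 0 := by
    rw [hK]
    simp only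
    rw [hνl 0 h0S]
  rw [hK0] at hchar
  obtain ⟨C, hC, ρ, hρ, htaylor⟩ := exists_taylor_bound ((hFC 0 h0S).of_le h2)
  have hqball : ∀ᶠ t in 𝓝 (0 : ℝ), q t ∈ Metric.ball (q 0) (ρ / 2) :=
    (hqC 0 h0S).continuousAt.eventually_mem (Metric.ball_mem_nhds _ (by positivity))
  obtain ⟨τ, hτ, L, hL, ε₀, hε₀, hτU, hmain⟩ := exists_uniform_bound_of_gappedAt
    (M := fun t => K t + B t) hg hKC (hKC.add hBC)
    ((hrC 0 h0S).of_le h2) hμ₀ hμpos hchar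
    (eventually_of_mem hSn hgapped)
    (eventually_of_mem hSn fun t ht x => by
      rw [add_apply, add_sub_cancel_left]
      refine (hBn t ht x).trans ?_
      gcongr
      have := min_le_left g d
      linarith)
    -- In the equation for `b'`, `19 * C` bounds the error on `r` and `6 * C` the error on `a`; the
    -- added 1 covers the factor `1 / 2` in the norm constraint.
    (D := 25 * C + 1) (ρ := min 1 (ρ / 13)) (by positivity) (by positivity)
    (inter_mem hSn hqball)
  have hτS : ∀ t, |t| < τ → t ∈ S := fun t ht => (hτU t ht).1
  refine ⟨τ, hτ, 2 * L + 2 / ε₀, fun t ht => hST₁ (hτS t ht), ?_⟩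
  intro t ht ε hε v hv hv0
  have hvn : ∀ t, |t| < τ → ‖v t‖ = 1 := fun t ht =>
    IsSolution.norm_eq_one hH hreal hε isOpen_Ioo (convex_Ioo _ _).isPreconnected
      (fun t ht => hT₁T (hST₁ (hτS t (abs_lt.2 ht)))) ⟨by linarith, hτ⟩ hv
      (by rw [hv0]; exact hw.norm_eq 0 h0) t (abs_lt.1 ht)
  set Λ : ℝ → ℝ := fun t => ∫ s in (0 : ℝ)..t, lam j₀ (s, occ hp (w s)) with hΛ
  have hφn : ∀ x : ℝ, ‖Complex.exp (Complex.I / (ε : ℂ) * (x : ℂ))‖ = 1 := fun x => by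
    rw [show Complex.I / (ε : ℂ) * (x : ℂ) = ((x / ε : ℝ) : ℂ) * Complex.I by push_cast; ring]
    exact Complex.norm_exp_ofReal_mul_I _
  have hφm : ∀ x : ℝ, Complex.exp (Complex.I / (ε : ℂ) * (x : ℂ)) *
      Complex.exp (-(Complex.I / (ε : ℂ)) * (x : ℂ)) = 1 := fun x => by
    rw [← Complex.exp_add]; simp
  have hLε : 0 < L * ε := by positivity
  -- For `ε ≥ ε₀` the distance of two unit vectors, at most 2, is already below `2 / ε₀ * ε`.
  rcases le_or_gt ε₀ ε with hcase | hcase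
  · have h1 : ‖Complex.exp (-(Complex.I / (ε : ℂ)) * (Λ t : ℂ))‖ = 1 := by
      have := congrArg norm (hφm (Λ t))
      rwa [norm_mul, hφn, one_mul, norm_one] at this
    calc _ ≤ ‖v t‖ + ‖Complex.exp (-(Complex.I / (ε : ℂ)) * (Λ t : ℂ)) • w t‖ := norm_sub_le _ _
      _ = 2 := by
        rw [norm_smul, h1, hvn t ht, hw.norm_eq t (hST₁ (hτS t ht))]; norm_num
      _ ≤ 2 / ε₀ * ε := by
        rw [div_mul_eq_mul_div, le_div_iff₀ hε₀]; linarith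
      _ ≤ _ := by rw [add_mul]; linarith
  have hlamC : ContinuousOn (fun s => lam j₀ (s, occ hp (w s))) S :=
    ContinuousOn.congr (fun s hs => (hνC s hs).continuousAt.continuousWithinAt)
      fun s hs => (hνl s hs).symm
  have hΛd : ∀ t, |t| < τ → HasDerivAt Λ (lam j₀ (q t)) t := fun t ht => by
    have htS := hτS t ht
    refine intervalIntegral.integral_hasDerivAt_right ?_
      (hlamC.stronglyMeasurableAtFilter hSo t htS) (hlamC.continuousAt (hSo.mem_nhds htS))
    exact (hlamC.mono ((convex_Ioo _ _).ordConnected.uIcc_subset h0S htS)).intervalIntegrable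
  set φ : ℝ → ℂ := fun t => c * Complex.exp (Complex.I / (ε : ℂ) * (Λ t : ℂ)) with hφ
  have hφ1 : ∀ t, ‖φ t‖ = 1 := fun t => by rw [hφ, norm_mul, hφn, hc, one_mul]
  -- In this gauge `i ε u' = (H(t,[u]) - λ(t,[w])) u`, and `u 0` is the real vector `r 0`, so both
  -- deviations vanish initially.
  set u : ℝ → EuclideanSpace ℂ (Fin N) := fun t => φ t • v t with hu
  have hoccu : ∀ t, occ hp (u t) = occ hp (v t) := fun t => occ_smul_of_norm_eq_one (hφ1 t) _
  have hun : ∀ t, |t| < τ → ‖u t‖ = 1 := fun t ht => by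
    rw [hu, norm_smul, hφ1, hvn t ht, one_mul]
  have hmemu : ∀ t, |t| < τ → (t, occ hp (u t)) ∈ paramDomain p T X := fun t ht =>
    hH.occ_mem (hT₁T (hST₁ (hτS t ht))) (hun t ht)
  have hsys : ∀ t, |t| < τ →
      HasDerivAt (fun t => reVec (u t))
        (ε⁻¹ • (F (t, occ hp (u t)) (imVec (u t)) - lam j₀ (q t) • imVec (u t))) t ∧
      HasDerivAt (fun t => imVec (u t))
        (-(ε⁻¹ • (F (t, occ hp (u t)) (reVec (u t)) - lam j₀ (q t) • reVec (u t)))) t := fun t ht => by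
    obtain ⟨d1, d2⟩ := hv t (abs_lt.1 ht)
    obtain ⟨u', e1, e2⟩ := hasDerivAt_phase_smul c hε d1.hasDerivAt d2 (hΛd t ht)
    refine hasDerivAt_reVec_imVec (hreal _ (hmemu t ht)) (z := u) (l := lam j₀ (q t)) hε e1 ?_
    rw [e2, hoccu, hu]
    simp only [map_smul]
    rfl
  set a : ℝ → EuclideanSpace ℝ (Fin N) := fun t => reVec (u t) - r t with ha
  set b : ℝ → EuclideanSpace ℝ (Fin N) := fun t => imVec (u t) with hb
  have hrd : ∀ t, |t| < τ → HasDerivAt r (deriv r t) t := fun t ht =>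
    ((hrC t (hτS t ht)).differentiableAt (by simp)).hasDerivAt
  have hu0 : u 0 = ofRealVec (r 0) := by
    have : φ 0 = c := by simp [hφ, hΛ]
    rw [hr, ← hcw 0 h0S, hu]
    simp only
    rw [this, hv0]
  have hfin := hmain ε hε hcase a
    (fun t => ε⁻¹ • (F (t, occ hp (u t)) (imVec (u t)) - lam j₀ (q t) • imVec (u t)) - deriv r t) b
    (fun t => -(ε⁻¹ • (F (t, occ hp (u t)) (reVec (u t)) - lam j₀ (q t) • reVec (u t))))
    (by simp only [ha, hu0, reVec_ofRealVec, sub_self])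
    (by simp only [hb, hu0, imVec_ofRealVec])
    (fun t ht => ⟨(hsys t ht).1.sub (hrd t ht), (hsys t ht).2⟩) ?_ t ht
  · have h1 : φ t • (v t - Complex.exp (-(Complex.I / (ε : ℂ)) * (Λ t : ℂ)) • w t)
        = u t - ofRealVec (r t) := by
      rw [smul_sub, smul_smul, hφ]
      simp only
      rw [mul_assoc, hφm, mul_one, hcw t (hτS t ht)]
    have h2 : ‖v t - Complex.exp (-(Complex.I / (ε : ℂ)) * (Λ t : ℂ)) • w t‖
        = ‖u t - ofRealVec (r t)‖ := by rw [← h1, norm_smul, hφ1, one_mul]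
    have h3 := norm_le_reVec_add_imVec (u t - ofRealVec (r t))
    rw [map_sub, map_sub, reVec_ofRealVec, imVec_ofRealVec, sub_zero] at h3
    have h4 : 0 ≤ 2 / ε₀ * ε := by positivity
    calc _ ≤ ‖a t‖ + ‖b t‖ := h2.trans_le h3
      _ ≤ L * ε + L * ε := add_le_add hfin.1 hfin.2
      _ ≤ _ := by rw [add_mul]; linarith
  · intro t ht hat hbt
    have htS := hτS t ht
    have hreu : reVec (u t) = r t + a t := by simp [ha]
    obtain ⟨q1, q2⟩ := quadratic_remainder hp hC htaylor (hrn t htS)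
      (hat.trans (min_le_left _ _)) (hbt.trans (min_le_left _ _))
      (hat.trans (min_le_right _ _)) (hbt.trans (min_le_right _ _)) hreu rfl (hocc t htS)
      (hτU t ht).2
    have hsa := sq_nonneg ‖a t‖
    have hsb := sq_nonneg ‖b t‖
    have hlow : ∀ y : EuclideanSpace ℝ (Fin N), ‖y‖ = ‖a t‖ ∨ ‖y‖ = ‖b t‖ → 3 * C * (‖a t‖ + ‖b t‖) * ‖y‖
        ≤ 6 * C * (‖a t‖ ^ 2 + ‖b t‖ ^ 2) := by
      intro y hy
      have : (‖a t‖ + ‖b t‖) * ‖y‖ ≤ 2 * (‖a t‖ ^ 2 + ‖b t‖ ^ 2) := by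
        rcases hy with hy | hy <;> rw [hy]
        · exact add_mul_self_le _ _
        · rw [add_comm ‖a t‖, add_comm (‖a t‖ ^ 2)]
          exact add_mul_self_le _ _
      calc 3 * C * (‖a t‖ + ‖b t‖) * ‖y‖ = 3 * C * ((‖a t‖ + ‖b t‖) * ‖y‖) := by ring
        _ ≤ 3 * C * (2 * (‖a t‖ ^ 2 + ‖b t‖ ^ 2)) := by gcongr
        _ = _ := by ring
    have hCs : 0 ≤ C * (‖a t‖ ^ 2 + ‖b t‖ ^ 2) := by positivity
    have hKt : ∀ y, K t y = F (q t) y - lam j₀ (q t) • y := fun y => by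
      rw [hK]
      simp only
      rw [hνl t htS]
      rfl
    refine ⟨?_, ?_, ?_⟩
    · have h1 : ε • (ε⁻¹ • (F (t, occ hp (u t)) (imVec (u t)) - lam j₀ (q t) • imVec (u t))
          - deriv r t) - K t (b t) + ε • deriv r t
          = F (t, occ hp (u t)) (b t) - F (t, occ hp (w t)) (b t) := by
        rw [hKt, smul_sub, smul_inv_smul₀ hε.ne']
        simp only [hb, hq]
        abel
      rw [h1]
      have h2 := (q1 (b t)).trans (hlow (b t) (Or.inr rfl))
      linarith
    · have h1 : ε • -(ε⁻¹ • (F (t, occ hp (u t)) (reVec (u t)) - lam j₀ (q t) • reVec (u t)))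
          + (K t + B t) (a t)
          = -(F (t, occ hp (u t)) (r t) - F (t, occ hp (w t)) (r t)
              - occDeriv hp (fderiv ℝ F (t, occ hp (w t))) (r t) (a t))
            - (F (t, occ hp (u t)) (a t) - F (t, occ hp (w t)) (a t)) := by
        have h2 := hFr t htS
        rw [smul_neg, smul_inv_smul₀ hε.ne', add_apply, hKt, hreu, map_add, smul_add, ← h2]
        simp only [hB, hq]
        abel
      rw [h1]
      refine (norm_sub_le _ _).trans ?_
      rw [norm_neg]
      have h2 := (q1 (a t)).trans (hlow (a t) (Or.inl rfl))
      linarith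
    -- Expanding `1 = ‖r + a‖ ^ 2 + ‖b‖ ^ 2` gives `⟨r, a⟩ = -(‖a‖ ^ 2 + ‖b‖ ^ 2) / 2`.
    · have h1 := norm_sq_eq_reVec_add_imVec (u t)
      rw [hun t ht, hreu, norm_add_sq_real, hrn t htS] at h1
      have h2 : inner ℝ (r t) (a t) = -((‖a t‖ ^ 2 + ‖b t‖ ^ 2) / 2) := by
        simp only [hb]
        linarith
      rw [h2, abs_neg, abs_of_nonneg (by positivity)]
      linarith

end NonlinearAdiabatic

theorem theorem1 {N p : ℕ} (hp : p ≤ N) (g d : ℝ) (hg : 0 < g) (hd : 0 < d) :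
    ∃ δ₀ : ℝ, 0 < δ₀ ∧
      ∀ (T X : Set ℝ) (H : ℝ × (Fin p → ℝ) → NonlinearAdiabatic.Op N)
        (lam : Fin N → ℝ × (Fin p → ℝ) → ℝ) (j₀ : Fin N) (δ : ℝ),
        0 < δ → δ < δ₀ →
        NonlinearAdiabatic.SmoothSelfAdjoint T X H →
        NonlinearAdiabatic.PartialsBounded T X H δ →
        NonlinearAdiabatic.SimpleGappedSpectrum T X H lam g →
        (∀ q ∈ NonlinearAdiabatic.paramDomain p T X, NonlinearAdiabatic.IsRealOp (H q)) →
        NonlinearAdiabatic.Generic T X H (lam j₀) →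
        NonlinearAdiabatic.GenericMargin lam j₀ d →
        ∀ (T₁ : Set ℝ) (w : ℝ → EuclideanSpace ℂ (Fin N)),
          IsOpen T₁ → (0 : ℝ) ∈ T₁ → T₁ ⊆ T →
          NonlinearAdiabatic.IsNonlinearEigenvector hp H (lam j₀) T₁ w →
          ∃ T₀ : Set ℝ, IsOpen T₀ ∧ T₀.OrdConnected ∧ (0 : ℝ) ∈ T₀ ∧ T₀ ⊆ T₁ ∧
            ∀ t ∈ T₀, ∃ C : ℝ, ∀ ε : ℝ, 0 < ε →
              ∀ v : ℝ → EuclideanSpace ℂ (Fin N),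
                NonlinearAdiabatic.IsSolution hp H ε T₀ v → v 0 = w 0 →
                ‖v t - Complex.exp (-(Complex.I / (ε : ℂ)) *
                    ((∫ s in (0 : ℝ)..t,
                      lam j₀ (s, NonlinearAdiabatic.occ hp (w s)) : ℝ) : ℂ)) • w t‖
                  ≤ C * ε := by
  -- Chosen so that `2 * p * δ ≤ min g d / 4`; `p + 1` keeps the denominator positive when `p = 0`.
  refine ⟨min g d / (8 * (p + 1)), by positivity, ?_⟩
  intro T X H lam j₀ δ hδ0 hδ hH hpart hspec hreal _ hmargin T₁ w hT₁ h0 hT₁T hw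
  rw [lt_div_iff₀ (by positivity), mul_comm] at hδ
  obtain ⟨τ, hτ, B, hτT, hB⟩ := NonlinearAdiabatic.exists_adiabatic_bound hp hg hd hδ.le hδ0 hH
    hpart hspec hreal hmargin hT₁ h0 hT₁T hw
  exact ⟨Ioo (-τ) τ, isOpen_Ioo, ordConnected_Ioo, ⟨by linarith, hτ⟩,
    fun t ht => hτT t (abs_lt.2 ht), fun t ht => ⟨B, hB t (abs_lt.2 ht)⟩⟩
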